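/- Let $G$ be a locally compact (Hausdorff) group with left Haar measure. Let $\lambda$ be its left regular representation on $L^2(G)$, let $B(G)$ be the Fourier--Stieltjes algebra, i.e. the space of coefficients $\varphi(s)=\langle\pi(s)\xi,\eta\rangle$ of strongly continuous unitary representations of $G$ with norm $\|\varphi\|_{B(G)}=\inf\|\xi\|\|\eta\|$ over all such decompositions, and let the Fourier algebra $A(G)$ be the closed linear span in $B(G)$ of the coefficients of $\lambda$, with the norm $\|\cdot\|_{A(G)}$ of $B(G)$. Let $LG$ be the closure of $\lambda(L^1(G))$ in $\mathbf{B}(L^2(G))$ for the strong operator topology. A function $\varphi:G\to\mathbb{C}$ is a multiplier of $A(G)$ if $\varphi A(G)\subseteq A(G)$; it is a completely bounded multiplier, $\varphi\in M_0A(G)$, if moreover the weak*-continuous linear map $M_\varphi:LG\to LG$ with $M_\varphi\lambda(f)=\lambda(\varphi f)$ for all $f\in L^1(G)$ (the dual of $a\mapsto\varphi a$ on $A(G)$) is completely bounded, and then $\|\varphi\|_{M_0A(G)}=\|M_\varphi\|_{\mathrm{cb}}$. The group $G$ is weakly amenable if for some $C\geq 1$ there is a net $(a_i)$ in $A(G)$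 with $\|a_i\|_{M_0A(G)}\leq C$ for all $i$ and $a_i\to 1$ uniformly on compact subsets of $G$; $\boldsymbol\Lambda(G)$ is the infimum of all such $C\geq 1$ ($\infty$ if there is none). Suppose that $G$ is amenable, i.e. that there is a functional $m\in L^\infty(G)^*$ that is positive, invariant under left translations, and satisfies $m(1)=1$. Then: 1. There is a net $(a_i)$ in $A(G)$ with $\|a_i\|_{A(G)}\leq 1$ and $\|a_i\|_{M_0A(G)}\leq 1$ for all $i$, which converges to $1$ uniformly on compact subsets of $G$. 2. $G$ is weakly amenable, and $\boldsymbol\Lambda(G)=1$. -/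

import Mathlib

open MeasureTheory Filter Topology
open scoped ENNReal NNReal

universe u

namespace WeakAmen

section Translation

variable {G : Type u} [Group G] [TopologicalSpace G] [IsTopologicalGroup G]
  [MeasurableSpace G] [BorelSpace G]

/-- Left translation `(δ_t * f)(x) = f (t⁻¹ x)` as a linear isometry of `L^p(G)`, with respect to
a left invariant measure `μ`. -/
noncomputable def leftTranslate (μ : Measure G) [μ.IsHaarMeasure] (p : ℝ≥0∞) [Fact (1 ≤ p)]
    (t : G) : Lp ℂ p μ →ₗᵢ[ℂ] Lp ℂ p μ :=
  Lp.compMeasurePreservingₗᵢ ℂ (fun x => t⁻¹ * x) (measurePreserving_mul_left μ t⁻¹)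

/-- `G` is amenable: there is a functional `m` in the dual of `L^∞(G)` which is positive,
left invariant, and satisfies `m 1 = 1`. -/
def IsAmenable (μ : Measure G) [μ.IsHaarMeasure] : Prop :=
  ∃ m : Lp ℂ ∞ μ →L[ℂ] ℂ,
    (∀ f : Lp ℂ ∞ μ, (∀ᵐ x ∂μ, 0 ≤ (f x).re ∧ (f x).im = 0) → 0 ≤ (m f).re ∧ (m f).im = 0) ∧
    (∀ (t : G) (f : Lp ℂ ∞ μ), m (leftTranslate μ ∞ t f) = m f) ∧
    m ((memLp_top_const (1 : ℂ)).toLp (fun _ : G => (1 : ℂ))) = 1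

end Translation

section FourierStieltjes

/-- A unitary representation of the topological group `G` on the Hilbert space `H`,
continuous for the strong operator topology. -/
structure UnitaryRep (G : Type u) [Group G] [TopologicalSpace G]
    (H : Type u) [NormedAddCommGroup H] [InnerProductSpace ℂ H] [CompleteSpace H] where
  toHom : G →* unitary (H →L[ℂ] H)
  continuous_apply : ∀ ξ : H, Continuous fun s : G => (toHom s : H →L[ℂ] H) ξ

/-- `‖φ‖_{B(G)} = inf ‖ξ‖ ‖η‖` over all ways of writing `φ s = ⟨π(s) ξ, η⟩` with `π` a unitary
representation of `G` (`⟨·,·⟩` is linear in the first variable; Mathlib's `inner` is linear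
in the second). The value is `∞` when `φ` is not a coefficient of a unitary representation. Every
coefficient is one of a representation on a Hilbert space in the universe of `G`, with the same
vectors up to compression to the cyclic subspace. -/
noncomputable def bNorm {G : Type u} [Group G] [TopologicalSpace G] (φ : G → ℂ) : ℝ≥0∞ :=
  ⨅ (H : Type u) (_ : NormedAddCommGroup H) (_ : InnerProductSpace ℂ H) (_ : CompleteSpace H)
    (π : UnitaryRep G H) (ξ : H) (η : H)
    (_ : ∀ s : G, φ s = inner ℂ η ((π.toHom s : H →L[ℂ] H) ξ)), ‖ξ‖ₑ * ‖η‖ₑ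

/-- The Fourier--Stieltjes algebra `B(G)`: all coefficients of unitary representations. -/
def fourierStieltjes (G : Type u) [Group G] [TopologicalSpace G] : Set (G → ℂ) :=
  {φ | ∃ (H : Type u) (_ : NormedAddCommGroup H) (_ : InnerProductSpace ℂ H)
    (_ : CompleteSpace H) (π : UnitaryRep G H) (ξ : H) (η : H),
    ∀ s : G, φ s = inner ℂ η ((π.toHom s : H →L[ℂ] H) ξ)}

end FourierStieltjes

section FourierAlgebra

variable {G : Type u} [Group G] [TopologicalSpace G] [IsTopologicalGroup G]
  [MeasurableSpace G] [BorelSpace G]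

/-- The coefficients `s ↦ ⟨λ(s) ξ, η⟩` of the left regular representation on `L²(G)`. -/
def regularCoefficients (μ : Measure G) [μ.IsHaarMeasure] : Set (G → ℂ) :=
  {a | ∃ ξ η : Lp ℂ 2 μ, a = fun s => inner ℂ η (leftTranslate μ 2 s ξ)}

/-- The Fourier algebra `A(G)`: the closure in `B(G)`, for the norm of `B(G)`, of the linear span
of the coefficients of the left regular representation. -/
def fourierAlgebra (μ : Measure G) [μ.IsHaarMeasure] : Set (G → ℂ) :=
  {a | a ∈ fourierStieltjes G ∧
    ∀ ε : ℝ≥0∞, 0 < ε → ∃ b ∈ Submodule.span ℂ (regularCoefficients μ), bNorm (a - b) < ε}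

/-- `φ` is a multiplier of `A(G)`: pointwise multiplication by `φ` maps `A(G)` to itself. -/
def IsMultiplier (μ : Measure G) [μ.IsHaarMeasure] (φ : G → ℂ) : Prop :=
  ∀ a ∈ fourierAlgebra μ, φ * a ∈ fourierAlgebra μ

end FourierAlgebra

section VonNeumann

variable {G : Type u} [Group G] [TopologicalSpace G] [IsTopologicalGroup G]
  [LocallyCompactSpace G] [T2Space G] [MeasurableSpace G] [BorelSpace G]

set_option linter.unusedSectionVars false

/-- Strong continuity of the left regular representation. -/
theorem continuous_leftTranslate (μ : Measure G) [μ.IsHaarMeasure] [μ.Regular] (ξ : Lp ℂ 2 μ) :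
    Continuous fun s : G => leftTranslate μ 2 s ξ := by
  have : Fact ((2 : ℝ≥0∞) ≠ ∞) := ⟨by simp⟩
  have h : (fun s : G => leftTranslate μ 2 s ξ) = fun s : G => DomMulAct.mk s⁻¹ • ξ := by
    funext s
    rfl
  rw [h]
  exact (DomMulAct.continuous_mk.comp continuous_inv).smul continuous_const

/-- A continuous function is almost everywhere strongly measurable on sets of finite measure. -/
theorem aestronglyMeasurable_restrict_of_continuous {E : Type*} [NormedAddCommGroup E]
    (μ : Measure G) [μ.IsHaarMeasure] [μ.Regular] {F : G → E} (hF : Continuous F)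
    {s : Set G} (hs : MeasurableSet s) (hμ : μ s ≠ ∞) :
    AEStronglyMeasurable F (μ.restrict s) := by
  have key : ∀ n : ℕ, ∃ K ⊆ s, IsCompact K ∧ IsClosed K ∧ μ (s \ K) < ((n : ℝ≥0∞) + 1)⁻¹ := fun n =>
    hs.exists_isCompact_isClosed_sdiff_lt hμ (by simp)
  choose K hKs hKc hKcl hK using key
  have h1 : AEStronglyMeasurable F (μ.restrict (⋃ n, K n)) :=
    AEStronglyMeasurable.iUnion fun n =>
      hF.continuousOn.aestronglyMeasurable_of_isCompact (hKc n) (hKcl n).measurableSet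
  have h0 : μ (s \ ⋃ n, K n) = 0 := by
    refine le_antisymm (ge_of_tendsto ENNReal.tendsto_inv_nat_nhds_zero ?_) zero_le
    filter_upwards [eventually_ge_atTop 1] with n hn
    obtain ⟨m, rfl⟩ := Nat.exists_eq_succ_of_ne_zero (Nat.one_le_iff_ne_zero.1 hn)
    refine (measure_mono (Set.sdiff_subset_sdiff_right (Set.subset_iUnion K m))).trans ?_
    simpa using (hK m).le
  have h2 : AEStronglyMeasurable F (μ.restrict (s \ ⋃ n, K n)) := by
    rw [Measure.restrict_eq_zero.2 h0]
    exact aestronglyMeasurable_zero_measure F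
  exact (aestronglyMeasurable_union_iff.2 ⟨h1, h2⟩).mono_measure
    (Measure.restrict_mono (fun x hx => by by_cases h : x ∈ ⋃ n, K n <;> simp_all) le_rfl)

theorem integrable_smul_leftTranslate (μ : Measure G) [μ.IsHaarMeasure] [μ.Regular]
    {g : G → ℂ} (hg : Integrable g μ) (ξ : Lp ℂ 2 μ) :
    Integrable (fun s => g s • leftTranslate μ 2 s ξ) μ := by
  have hc := continuous_leftTranslate μ ξ
  refine Integrable.mono' (hg.norm.mul_const ‖ξ‖) ?_
    (Eventually.of_forall fun s => by simp [norm_smul])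
  have hfin := (memLp_one_iff_integrable.2 hg).aefinStronglyMeasurable (by simp) (by simp)
  set t := hfin.sigmaFiniteSet with ht
  have htm : MeasurableSet t := hfin.measurableSet
  have : SigmaFinite (μ.restrict t) := hfin.sigmaFinite_restrict
  have hFt : AEStronglyMeasurable (fun s => leftTranslate μ 2 s ξ) (μ.restrict t) := by
    have h : ∀ n, AEStronglyMeasurable (fun s => leftTranslate μ 2 s ξ)
        ((μ.restrict t).restrict (spanningSets (μ.restrict t) n)) := fun n => by
      have hm := measurableSet_spanningSets (μ.restrict t) n
      rw [Measure.restrict_restrict hm]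
      refine aestronglyMeasurable_restrict_of_continuous μ hc (hm.inter htm) ?_
      rw [← Measure.restrict_apply hm]
      exact (measure_spanningSets_lt_top (μ.restrict t) n).ne
    have h' := AEStronglyMeasurable.iUnion h
    rwa [iUnion_spanningSets, Measure.restrict_univ] at h'
  have h1 : AEStronglyMeasurable (fun s => g s • leftTranslate μ 2 s ξ) (μ.restrict t) :=
    (hg.1.mono_measure Measure.restrict_le_self).smul hFt
  have h2 : AEStronglyMeasurable (fun s => g s • leftTranslate μ 2 s ξ) (μ.restrict tᶜ) := by
    refine (aestronglyMeasurable_const (b := (0 : Lp ℂ 2 μ))).congr ?_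
    filter_upwards [hfin.ae_eq_zero_compl] with s hs
    rw [hs, Pi.zero_apply, zero_smul]
  have h3 := aestronglyMeasurable_union_iff.2 ⟨h1, h2⟩
  rwa [Set.union_compl_self, Measure.restrict_univ] at h3

/-- The integrated left regular representation `λ : L¹(G) → B(L²(G))`,
`λ(g) ξ = ∫ g(s) λ(s) ξ ds`, that is, `λ(g) ξ = g * ξ`. -/
noncomputable def regularL1 (μ : Measure G) [μ.IsHaarMeasure] [μ.Regular] :
    Lp ℂ 1 μ →ₗ[ℂ] (Lp ℂ 2 μ →L[ℂ] Lp ℂ 2 μ) where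
  toFun g := LinearMap.mkContinuous
    { toFun := fun ξ => ∫ s, g s • leftTranslate μ 2 s ξ ∂μ
      map_add' := fun ξ η => by
        simp only [map_add, smul_add]
        exact integral_add (integrable_smul_leftTranslate μ (L1.integrable_coeFn g) ξ)
          (integrable_smul_leftTranslate μ (L1.integrable_coeFn g) η)
      map_smul' := fun c ξ => by
        simp only [map_smul, smul_comm _ c, RingHom.id_apply]
        exact integral_smul c _ }
    ‖g‖ (fun ξ => by
      refine (norm_integral_le_integral_norm _).trans (le_of_eq ?_)
      simp only [norm_smul, LinearIsometry.norm_map]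
      rw [integral_mul_const, L1.norm_eq_integral_norm])
  map_add' f g := by
    ext1 ξ
    change ∫ s, (f + g) s • leftTranslate μ 2 s ξ ∂μ
      = (∫ s, f s • leftTranslate μ 2 s ξ ∂μ) + ∫ s, g s • leftTranslate μ 2 s ξ ∂μ
    rw [← integral_add (integrable_smul_leftTranslate μ (L1.integrable_coeFn f) ξ)
      (integrable_smul_leftTranslate μ (L1.integrable_coeFn g) ξ)]
    refine integral_congr_ae ?_
    filter_upwards [Lp.coeFn_add f g] with s hs
    rw [hs, Pi.add_apply, add_smul]
  map_smul' c f := by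
    ext1 ξ
    change ∫ s, (c • f) s • leftTranslate μ 2 s ξ ∂μ
      = c • ∫ s, f s • leftTranslate μ 2 s ξ ∂μ
    rw [← integral_smul]
    refine integral_congr_ae ?_
    filter_upwards [Lp.coeFn_smul c f] with s hs
    rw [hs, Pi.smul_apply, smul_assoc]

/-- An operator on `L²(G)` regarded as a function `L²(G) → L²(G)`; the topology that the product
topology on functions induces on operators is the strong operator topology. -/
noncomputable def operatorToFun (μ : Measure G) :
    (Lp ℂ 2 μ →L[ℂ] Lp ℂ 2 μ) →ₗ[ℂ] (Lp ℂ 2 μ → Lp ℂ 2 μ) where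
  toFun T := fun ξ => T ξ
  map_add' _ _ := rfl
  map_smul' _ _ := rfl

/-- The group von Neumann algebra `LG`, as a subspace of `B(L²(G))`: the closure of `λ(L¹(G))` for
the strong operator topology. -/
noncomputable def groupVN (μ : Measure G) [μ.IsHaarMeasure] [μ.Regular] :
    Submodule ℂ (Lp ℂ 2 μ →L[ℂ] Lp ℂ 2 μ) :=
  Submodule.comap (operatorToFun μ)
    (Submodule.map (operatorToFun μ) (LinearMap.range (regularL1 μ))).topologicalClosure

/-- The elements of `LG` are the operators that are strong limits of operators `λ(g)`. -/
theorem mem_groupVN_iff (μ : Measure G) [μ.IsHaarMeasure] [μ.Regular]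
    (T : Lp ℂ 2 μ →L[ℂ] Lp ℂ 2 μ) :
    T ∈ groupVN μ ↔ (fun ξ => T ξ) ∈ closure (Set.range fun g : Lp ℂ 1 μ =>
      (fun ξ => regularL1 μ g ξ : Lp ℂ 2 μ → Lp ℂ 2 μ)) := by
  have h : ((Submodule.map (operatorToFun μ) (LinearMap.range (regularL1 μ)) :
      Submodule ℂ (Lp ℂ 2 μ → Lp ℂ 2 μ)) : Set (Lp ℂ 2 μ → Lp ℂ 2 μ)) =
      Set.range fun g : Lp ℂ 1 μ => (fun ξ => regularL1 μ g ξ : Lp ℂ 2 μ → Lp ℂ 2 μ) := by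
    rw [Submodule.map_coe, LinearMap.coe_range, ← Set.range_comp]
    rfl
  rw [← h]
  rfl

theorem regularL1_mem_groupVN (μ : Measure G) [μ.IsHaarMeasure] [μ.Regular] (g : Lp ℂ 1 μ) :
    regularL1 μ g ∈ groupVN μ :=
  Submodule.le_topologicalClosure _ ⟨_, ⟨g, rfl⟩, rfl⟩

end VonNeumann

section CompletelyBounded

variable {H : Type u} [NormedAddCommGroup H] [InnerProductSpace ℂ H]

/-- The operator on the Hilbert sum `Hⁿ` given by an `n × n` matrix of operators on `H`:
`(x ζ)_i = ∑ j, x_{ij} ζ_j`. -/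
noncomputable def matrixOp {n : ℕ} (x : Fin n → Fin n → H →L[ℂ] H) :
    PiLp 2 (fun _ : Fin n => H) →L[ℂ] PiLp 2 (fun _ : Fin n => H) :=
  (PiLp.continuousLinearEquiv 2 ℂ (fun _ : Fin n => H)).symm.toContinuousLinearMap ∘L
    ContinuousLinearMap.pi fun i => ∑ j, x i j ∘L PiLp.proj 2 (fun _ : Fin n => H) j

/-- The completely bounded norm `sup_n ‖u_n‖` of a linear map `u` from a space `S` of operators on
`H` to itself, where `u_n` applies `u` entrywise to matrices in `M_n(S) ⊆ B(Hⁿ)`. It is `∞` when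
`u` is not completely bounded. -/
noncomputable def cbNorm {S : Submodule ℂ (H →L[ℂ] H)} (u : S →ₗ[ℂ] S) : ℝ≥0∞ :=
  ⨆ (n : ℕ) (x : Fin n → Fin n → S) (_ : ‖matrixOp fun i j => (x i j : H →L[ℂ] H)‖ ≤ 1),
    ‖matrixOp fun i j => (u (x i j) : H →L[ℂ] H)‖ₑ

/-- The weak-* (ultraweak) topology on a space `S` of operators on `H`: the coarsest topology for
which all functionals `T ↦ Tr (T y) = ∑ k, ⟨T ξ_k, η_k⟩` are continuous, where
`y = ∑ k, ⟨·, η_k⟩ ξ_k` with `∑ k, ‖ξ_k‖² < ∞` and `∑ k, ‖η_k‖² < ∞` is an arbitrary trace class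
operator. -/
@[reducible]
noncomputable def ultraweak (S : Submodule ℂ (H →L[ℂ] H)) : TopologicalSpace S :=
  TopologicalSpace.induced
    (fun (T : S) (y : {y : (ℕ → H) × (ℕ → H) //
        (Summable fun k => ‖y.1 k‖ ^ 2) ∧ (Summable fun k => ‖y.2 k‖ ^ 2)}) =>
      ∑' k, inner ℂ (y.1.2 k) ((T : H →L[ℂ] H) (y.1.1 k)))
    inferInstance

end CompletelyBounded

section WeakAmenability

variable {G : Type u} [Group G] [TopologicalSpace G] [IsTopologicalGroup G]
  [LocallyCompactSpace G] [T2Space G] [MeasurableSpace G] [BorelSpace G]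

/-- `M` is the map `M_φ : LG → LG` attached to the multiplier `φ` of `A(G)`, that is, the dual of
`a ↦ φ a` on `A(G)`: the weak-*-weak-*-continuous linear map with `M_φ (λ(f)) = λ(φ f)` for all
`f ∈ L¹(G)`. It is unique because `λ(L¹(G))` is weak-*-dense in `LG`. -/
structure IsMultiplierMap (μ : Measure G) [μ.IsHaarMeasure] [μ.Regular] (φ : G → ℂ)
    (M : groupVN μ →ₗ[ℂ] groupVN μ) : Prop where
  isMultiplier : IsMultiplier μ φ
  continuous_ultraweak : Continuous[ultraweak (groupVN μ), ultraweak (groupVN μ)] M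
  map_regular : ∀ f : Lp ℂ 1 μ, ∃ g : Lp ℂ 1 μ, (∀ᵐ s ∂μ, g s = φ s * f s) ∧
    M ⟨regularL1 μ f, regularL1_mem_groupVN μ f⟩ = ⟨regularL1 μ g, regularL1_mem_groupVN μ g⟩

/-- `‖φ‖_{M₀A(G)} = ‖M_φ‖_cb`, with the value `∞` when `φ` is not a completely bounded multiplier
of `A(G)` (the infimum is over the only possible map `M_φ`). -/
noncomputable def m0Norm (μ : Measure G) [μ.IsHaarMeasure] [μ.Regular] (φ : G → ℂ) : ℝ≥0∞ :=
  ⨅ (M : groupVN μ →ₗ[ℂ] groupVN μ) (_ : IsMultiplierMap μ φ M), cbNorm M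

/-- There is a net in `A(G)` with `‖a_i‖_{M₀A(G)} ≤ C` that converges to `1` uniformly on compact
sets. -/
def HasApproxOne (μ : Measure G) [μ.IsHaarMeasure] [μ.Regular] (C : ℝ≥0) : Prop :=
  ∃ (ι : Type u) (_ : Nonempty ι) (_ : Preorder ι) (_ : IsDirectedOrder ι) (a : ι → G → ℂ),
    (∀ i, a i ∈ fourierAlgebra μ) ∧ (∀ i, m0Norm μ (a i) ≤ C) ∧
    ∀ K : Set G, IsCompact K → TendstoUniformlyOn a (fun _ => 1) atTop K

/-- Weak amenability. -/
def IsWeaklyAmenable (μ : Measure G) [μ.IsHaarMeasure] [μ.Regular] : Prop :=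
  ∃ C : ℝ≥0, 1 ≤ C ∧ HasApproxOne μ C

/-- The Cowling--Haagerup constant `Λ(G)`, equal to `∞` if `G` is not weakly amenable. -/
noncomputable def cowlingHaagerup (μ : Measure G) [μ.IsHaarMeasure] [μ.Regular] : ℝ≥0∞ :=
  ⨅ (C : ℝ≥0) (_ : 1 ≤ C ∧ HasApproxOne μ C), (C : ℝ≥0∞)

end WeakAmenability

end WeakAmen

/-! Amenability yields unit vectors `ξ` in `L²(G)` that are almost invariant under any given compact
set (Reiter's condition). The coefficients `a(s) = ⟨λ(s)ξ, ξ⟩` lie in `A(G)`, have norm at most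
`‖ξ‖² = 1`, and satisfy `|a(s) - 1| ≤ ‖λ(s)ξ - ξ‖`; so everything except the bound on `m0Norm`
follows at once from Reiter's condition.

Reiter's condition comes from the invariant mean by a Hahn–Banach argument in `L¹(G)`: if no convex
combination of translates of `v₀` made all the convolutions `(δ_s * v₀ - v₀) * v` small, for
finitely many `s`, a separating functional would produce a bounded continuous function bounded below
by some `δ > 0` whose mean is `0` (`mean_convCoefficient_translate`, `exists_norm_conv_lt`).
Convolution with `v₀` passes from finite to compact sets, and a square root passes from `L¹` to
`L²`.

The bound on `m0Norm` holds for every coefficient `φ(s) = ⟨π(s)ζ, ζ⟩` with `‖ζ‖ ≤ 1` that is a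
multiplier. By Fell's absorption (`inner_fell_translate_fell`), `η ↦ (x ↦ η(x) π(x)⁻¹ζ)` is a
contraction `U` from `L²(G)` to `L²(G; H)`, a Hilbert sum of copies of `L²(G)`, and `T ↦ U*(1 ⊗ T)U`
sends `λ(f)` to `λ(φf)`. A map of this form is completely contractive and ultraweakly continuous; it
preserves `LG` because `λ(L¹(G))` is ultrastrongly dense there (`exists_norm_amp_sub_lt`). The same
absorption identity shows that coefficients of `λ` are multipliers of `A(G)`. -/

namespace WeakAmen

/-! ### Translations on vector-valued `L^p` and the Haar integral on `L¹` -/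

section Translate

/-- The integral as a continuous functional on `L¹(G)`. -/
noncomputable def haarIntegral {α : Type*} {_ : MeasurableSpace α} (μ : Measure α) :
    Lp ℝ 1 μ →L[ℝ] ℝ := L1.integralCLM

theorem haarIntegral_apply {α : Type*} {_ : MeasurableSpace α} (μ : Measure α) (f : Lp ℝ 1 μ) :
    haarIntegral μ f = ∫ x, f x ∂μ :=
  (L1.integral_eq f).symm.trans (L1.integral_eq_integral f)

theorem abs_haarIntegral_le {α : Type*} {_ : MeasurableSpace α} (μ : Measure α) (f : Lp ℝ 1 μ) :
    |haarIntegral μ f| ≤ ‖f‖ := by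
  rw [haarIntegral_apply, L1.norm_eq_integral_norm]
  exact norm_integral_le_integral_norm (fun x => f x)

variable {G : Type u} [Group G] [TopologicalSpace G] [IsTopologicalGroup G]
  [MeasurableSpace G] [BorelSpace G]

/-- Left translation on vector valued `L^p`. -/
noncomputable def translate (𝕜 : Type*) [NormedRing 𝕜] {E : Type*} [NormedAddCommGroup E]
    [Module 𝕜 E] [IsBoundedSMul 𝕜 E] {p : ℝ≥0∞} [Fact (1 ≤ p)] (μ : Measure G) [μ.IsHaarMeasure]
    (t : G) : Lp E p μ →ₗᵢ[𝕜] Lp E p μ :=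
  Lp.compMeasurePreservingₗᵢ 𝕜 (fun x => t⁻¹ * x) (measurePreserving_mul_left μ t⁻¹)

variable {𝕜 : Type*} [NormedRing 𝕜] {E : Type*} [NormedAddCommGroup E]
    [Module 𝕜 E] [IsBoundedSMul 𝕜 E] {p : ℝ≥0∞} [Fact (1 ≤ p)] (μ : Measure G) [μ.IsHaarMeasure]

theorem translate_eq_leftTranslate (t : G) :
    (translate ℂ μ t : Lp ℂ p μ →ₗᵢ[ℂ] Lp ℂ p μ) = leftTranslate μ p t := rfl

theorem translate_eq_smul (t : G) (f : Lp E p μ) :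
    translate 𝕜 μ t f = DomMulAct.mk t⁻¹ • f := rfl

theorem coeFn_translate (t : G) (f : Lp E p μ) :
    translate 𝕜 μ t f =ᵐ[μ] fun x => f (t⁻¹ * x) :=
  Lp.coeFn_compMeasurePreserving f (measurePreserving_mul_left μ t⁻¹)

theorem translate_mul (s t : G) (f : Lp E p μ) :
    translate 𝕜 μ (s * t) f = translate 𝕜 μ s (translate 𝕜 μ t f) := by
  simp only [translate_eq_smul, smul_smul, ← DomMulAct.mk_mul, mul_inv_rev]

theorem translate_one (f : Lp E p μ) : translate 𝕜 μ 1 f = f := by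
  simp [translate_eq_smul]

theorem continuous_translate [LocallyCompactSpace G] [T2Space G] [μ.Regular] (hp : p ≠ ∞)
    (f : Lp E p μ) : Continuous fun t : G => translate 𝕜 μ t f := by
  have : Fact (p ≠ ∞) := ⟨hp⟩
  exact (DomMulAct.continuous_mk.comp continuous_inv).smul continuous_const

theorem haarIntegral_translate (t : G) (f : Lp ℝ 1 μ) :
    haarIntegral μ (translate ℝ μ t f) = haarIntegral μ f := by
  rw [haarIntegral_apply, haarIntegral_apply, integral_congr_ae (coeFn_translate μ t f)]
  exact integral_mul_left_eq_self (fun x => f x) t⁻¹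

end Translate

/-! ### Bochner integrals of continuous functions against integrable densities -/

section Integrals

theorem norm_integral_smul_le {α : Type*} {_ : MeasurableSpace α} {μ : Measure α} {𝕜 : Type*}
    [RCLike 𝕜] {E : Type*} [NormedAddCommGroup E] [NormedSpace 𝕜 E] [NormedSpace ℝ E]
    (g : Lp 𝕜 1 μ) {F : α → E} {C : ℝ}
    (hC : ∀ s, ‖F s‖ ≤ C) : ‖∫ s, g s • F s ∂μ‖ ≤ ‖g‖ * C := by
  refine (norm_integral_le_of_norm_le ((L1.integrable_coeFn g).norm.mul_const C)
    (Eventually.of_forall fun s => ?_)).trans (le_of_eq ?_)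
  · rw [norm_smul]
    exact mul_le_mul_of_nonneg_left (hC s) (norm_nonneg _)
  · rw [integral_mul_const, L1.norm_eq_integral_norm]

variable {G : Type u} [Group G] [TopologicalSpace G] [IsTopologicalGroup G]
  [LocallyCompactSpace G] [T2Space G] [MeasurableSpace G] [BorelSpace G]
  {μ : Measure G} [μ.IsHaarMeasure] [μ.Regular]
  {𝕜 : Type*} [RCLike 𝕜] {E : Type*} [NormedAddCommGroup E] [NormedSpace 𝕜 E]

/-- When `G` is not σ-compact a continuous `F` need not be strongly measurable. The density `g`
vanishes off a σ-finite set, and on sets of finite measure inner regularity reduces to compact sets.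
-/
theorem aestronglyMeasurable_smul_of_continuous {p : ℝ≥0∞} (hp0 : p ≠ 0) (hp : p ≠ ∞)
    {g : G → 𝕜} (hg : MemLp g p μ) {F : G → E} (hF : Continuous F) :
    AEStronglyMeasurable (fun s => g s • F s) μ := by
  have hfin := hg.aefinStronglyMeasurable hp0 hp
  set t := hfin.sigmaFiniteSet with ht
  have htm : MeasurableSet t := hfin.measurableSet
  have : SigmaFinite (μ.restrict t) := hfin.sigmaFinite_restrict
  have hFt : AEStronglyMeasurable F (μ.restrict t) := by
    have h : ∀ n, AEStronglyMeasurable F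
        ((μ.restrict t).restrict (spanningSets (μ.restrict t) n)) := fun n => by
      have hm := measurableSet_spanningSets (μ.restrict t) n
      rw [Measure.restrict_restrict hm]
      refine aestronglyMeasurable_restrict_of_continuous μ hF (hm.inter htm) ?_
      rw [← Measure.restrict_apply hm]
      exact (measure_spanningSets_lt_top (μ.restrict t) n).ne
    have h' := AEStronglyMeasurable.iUnion h
    rwa [iUnion_spanningSets, Measure.restrict_univ] at h'
  have h1 : AEStronglyMeasurable (fun s => g s • F s) (μ.restrict t) :=
    (hg.1.mono_measure Measure.restrict_le_self).smul hFt
  have h2 : AEStronglyMeasurable (fun s => g s • F s) (μ.restrict tᶜ) := by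
    refine (aestronglyMeasurable_const (b := (0 : E))).congr ?_
    filter_upwards [hfin.ae_eq_zero_compl] with s hs
    rw [hs, Pi.zero_apply, zero_smul]
  have h3 := aestronglyMeasurable_union_iff.2 ⟨h1, h2⟩
  rwa [Set.union_compl_self, Measure.restrict_univ] at h3

theorem integrable_smul_of_continuous_of_bounded {g : G → 𝕜} (hg : Integrable g μ) {F : G → E}
    (hF : Continuous F) {C : ℝ} (hC : ∀ s, ‖F s‖ ≤ C) : Integrable (fun s => g s • F s) μ := by
  refine Integrable.mono' (hg.norm.mul_const C)
    (aestronglyMeasurable_smul_of_continuous one_ne_zero ENNReal.one_ne_top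
      (memLp_one_iff_integrable.2 hg) hF) (Eventually.of_forall fun s => ?_)
  rw [norm_smul]
  exact mul_le_mul_of_nonneg_left (hC s) (norm_nonneg _)

end Integrals

/-! ### Convolution on `L¹(G)` -/

section Averages

variable {G : Type u} [Group G] [TopologicalSpace G] [IsTopologicalGroup G]
  [LocallyCompactSpace G] [T2Space G] [MeasurableSpace G] [BorelSpace G]
  (μ : Measure G) [μ.IsHaarMeasure] [μ.Regular]

/-- The convolution `u * f = ∫ u(t) (δ_t * f) dt` on `L¹(G)`, as a continuous bilinear map. -/
noncomputable def conv : Lp ℝ 1 μ →L[ℝ] Lp ℝ 1 μ →L[ℝ] Lp ℝ 1 μ :=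
  LinearMap.mkContinuous₂
    (LinearMap.mk₂ ℝ (fun u f => ∫ t, u t • translate ℝ μ t f ∂μ)
      (fun u v f => by
        rw [← integral_add]
        · refine integral_congr_ae ?_
          filter_upwards [Lp.coeFn_add u v] with s hs
          rw [hs, Pi.add_apply, add_smul]
        all_goals
          exact integrable_smul_of_continuous_of_bounded (L1.integrable_coeFn _)
            (continuous_translate μ ENNReal.one_ne_top f)
            (fun _ => (LinearIsometry.norm_map _ f).le))
      (fun c u f => by
        rw [← integral_smul]
        refine integral_congr_ae ?_
        filter_upwards [Lp.coeFn_smul c u] with s hs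
        rw [hs, Pi.smul_apply, smul_assoc])
      (fun u f g => by
        simp only [map_add, smul_add]
        apply integral_add
        all_goals
          exact integrable_smul_of_continuous_of_bounded (L1.integrable_coeFn _)
            (continuous_translate μ ENNReal.one_ne_top _)
            (fun _ => (LinearIsometry.norm_map _ _).le))
      (fun c u f => by
        simp only [map_smul, smul_comm _ c]
        exact integral_smul c _)) 1
    (fun u f => by
      rw [one_mul]
      exact norm_integral_smul_le u (fun _ => (LinearIsometry.norm_map _ _).le))

theorem conv_apply (u f : Lp ℝ 1 μ) : conv μ u f = ∫ t, u t • translate ℝ μ t f ∂μ := rfl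

theorem integrable_smul_translate (u f : Lp ℝ 1 μ) :
    Integrable (fun t => u t • translate ℝ μ t f) μ :=
  integrable_smul_of_continuous_of_bounded (L1.integrable_coeFn _)
    (continuous_translate μ ENNReal.one_ne_top _) (fun _ => (LinearIsometry.norm_map _ _).le)

theorem norm_conv_le (u f : Lp ℝ 1 μ) : ‖conv μ u f‖ ≤ ‖u‖ * ‖f‖ :=
  norm_integral_smul_le u (fun _ => (LinearIsometry.norm_map _ _).le)

theorem conv_translate_left (s : G) (u f : Lp ℝ 1 μ) :
    conv μ (translate ℝ μ s u) f = translate ℝ μ s (conv μ u f) := by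
  rw [conv_apply, conv_apply]
  have h1 : ∫ t, translate ℝ μ s u t • translate ℝ μ t f ∂μ
      = ∫ t, u (s⁻¹ * t) • translate ℝ μ t f ∂μ := by
    refine integral_congr_ae ?_
    filter_upwards [coeFn_translate (𝕜 := ℝ) μ s u] with t ht
    rw [ht]
  rw [h1, ← integral_mul_left_eq_self _ s]
  have h2 := (translate ℝ μ s : Lp ℝ 1 μ →ₗᵢ[ℝ] Lp ℝ 1 μ).toContinuousLinearMap.integral_comp_comm
    (integrable_smul_translate μ u f)
  refine Eq.trans ?_ h2
  refine integral_congr_ae (Eventually.of_forall fun t => ?_)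
  simp [translate_mul]

/-- Convolution by `f` on the right is a bounded operator commuting with left translations, so it
passes under the integral defining `u * v`; Fubini is not needed. -/
theorem conv_assoc (u v f : Lp ℝ 1 μ) : conv μ (conv μ u v) f = conv μ u (conv μ v f) := by
  have h := ((conv μ).flip f).integral_comp_comm (integrable_smul_translate μ u v)
  rw [conv_apply μ u v, conv_apply μ u (conv μ v f)]
  refine Eq.trans h.symm ?_
  refine integral_congr_ae (Eventually.of_forall fun t => ?_)
  simp [conv_translate_left]

theorem haarIntegral_conv (u f : Lp ℝ 1 μ) :
    haarIntegral μ (conv μ u f) = haarIntegral μ u * haarIntegral μ f := by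
  rw [conv_apply, ← (haarIntegral μ).integral_comp_comm (integrable_smul_translate μ u f)]
  simp only [map_smul, haarIntegral_translate, smul_eq_mul]
  rw [integral_mul_const, haarIntegral_apply μ u]

end Averages

end WeakAmen

namespace WeakAmen

open scoped BoundedContinuousFunction Pointwise

/-! ### Right translation and the modular function -/

section RightTranslation

set_option linter.unusedSectionVars false

variable {G : Type u} [Group G] [TopologicalSpace G] [IsTopologicalGroup G]
  [LocallyCompactSpace G] [T2Space G] [MeasurableSpace G] [BorelSpace G]
  (μ : Measure G) [μ.IsHaarMeasure] [μ.Regular]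

/-- Integrals of right translates depend continuously on the translation parameter. -/
theorem continuous_integral_mul_right {b : G → ℝ} (hb : Continuous b) (hbs : HasCompactSupport b) :
    Continuous fun y => ∫ t, b (t * y) ∂μ := by
  refine continuous_iff_continuousAt.2 fun y₀ => ?_
  obtain ⟨Y, hY, hYy⟩ := exists_compact_mem_nhds y₀
  have hk : IsCompact (tsupport b * Y⁻¹) := hbs.isCompact.mul hY.inv
  have h : ContinuousOn (fun y => ∫ t, b (t * y) ∂μ) Y := by
    refine continuousOn_integral_of_compact_support (f := fun y t => b (t * y)) hk ?_ ?_
    · exact (hb.comp (continuous_snd.mul continuous_fst)).continuousOn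
    · intro y t hy ht
      by_contra hne
      refine ht ⟨t * y, subset_tsupport _ hne, y⁻¹, Set.inv_mem_inv.2 hy, by simp⟩
  exact h.continuousAt hYy

/-- The modular function: right translates of Haar measure are continuously varying multiples
of Haar measure. -/
theorem exists_continuous_map_mul_right_eq_smul :
    ∃ c : G → ℝ≥0, Continuous c ∧ (∀ y, 0 < c y) ∧
      ∀ y, Measure.map (fun t => t * y) μ = c y • μ := by
  have key : ∀ y, ∃ c : ℝ≥0, 0 < c ∧ Measure.map (fun t => t * y) μ = c • μ := fun y => by
    have hreg : (Measure.map (fun t => t * y) μ).Regular :=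
      Measure.Regular.map (Homeomorph.mulRight y)
    refine ⟨_, ?_, Measure.isMulLeftInvariant_eq_smul_of_regular
      (Measure.map (fun t => t * y) μ) μ⟩
    exact Measure.haarScalarFactor_pos_of_isHaarMeasure _ _
  choose c hc hcμ using key
  refine ⟨c, ?_, hc, hcμ⟩
  -- Uniqueness of Haar measure gives each `c y` separately; testing on one bump function expresses
  -- it as a quotient of integrals, hence continuous in `y`.
  obtain ⟨⟨b, hb⟩, hbs, hb0, hb1⟩ : ∃ f : C(G, ℝ), HasCompactSupport f ∧ 0 ≤ f ∧ f 1 ≠ 0 :=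
    exists_continuous_nonneg_pos 1
  have hpos : 0 < ∫ t, b t ∂μ := hb.integral_pos_of_hasCompactSupport_nonneg_nonzero hbs hb0 hb1
  have hc' : ∀ y, (c y : ℝ) = (∫ t, b (t * y) ∂μ) / ∫ t, b t ∂μ := fun y => by
    rw [eq_div_iff hpos.ne']
    have h := integral_map (μ := μ) (φ := fun t => t * y) (f := b)
      (Continuous.aemeasurable (by fun_prop)) hb.aestronglyMeasurable
    rw [← h, hcμ y, integral_smul_nnreal_measure, NNReal.smul_def, smul_eq_mul]
  have : Continuous fun y => (c y : ℝ) := by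
    simp_rw [hc']
    exact (continuous_integral_mul_right μ hb hbs).div_const _
  exact continuous_induced_rng.2 this

/-- For `u ∈ C_c(G)`, the function `u * δ_y ∈ L¹(G)` depends continuously on `y`, and
`(u * δ_y) * f = u * (δ_y * f)`. -/
theorem exists_continuous_conv_translate {u : G → ℝ} (hu : Continuous u)
    (hus : HasCompactSupport u) (hu1 : MemLp u 1 μ) :
    ∃ (R : G → Lp ℝ 1 μ) (C : ℝ), Continuous R ∧ (∀ y, ‖R y‖ ≤ C) ∧
      ∀ y f, conv μ (R y) f = conv μ (hu1.toLp u) (translate ℝ μ y f) := by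
  obtain ⟨c, hc, hc0, hcμ⟩ := exists_continuous_map_mul_right_eq_smul μ
  -- Right multiplication is a measurable embedding, so this change of variables needs no
  -- measurability of `F`.
  have hint : ∀ (y : G) {E : Type u} [NormedAddCommGroup E] [NormedSpace ℝ E] (F : G → E),
      ∫ t, F (t * y) ∂μ = (c y : ℝ) • ∫ t, F t ∂μ := fun y E _ _ F => by
    have h := (Homeomorph.mulRight y).isClosedEmbedding.measurableEmbedding.integral_map (μ := μ) F
    rw [← NNReal.smul_def, ← integral_smul_nnreal_measure, ← hcμ y]
    exact h.symm
  have hRc : ∀ y, Continuous fun t => (c y : ℝ) * u (t * y⁻¹) := fun y => by fun_prop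
  have hRs : ∀ y, HasCompactSupport fun t => (c y : ℝ) * u (t * y⁻¹) := fun y =>
    (hus.comp_homeomorph (Homeomorph.mulRight y⁻¹)).mul_left
  have hR : ∀ y, MemLp (fun t => (c y : ℝ) * u (t * y⁻¹)) 1 μ := fun y =>
    (hRc y).memLp_of_hasCompactSupport (hRs y)
  -- The factor `c y` makes `c(y) u(t y⁻¹)` the density of `u * δ_y`, with the same `L¹` norm as
  -- `u`.
  refine ⟨fun y => (hR y).toLp _, ∫ t, ‖u t‖ ∂μ, ?_, fun y => ?_, fun y f => ?_⟩
  · refine continuous_iff_continuousAt.2 fun y₀ => ?_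
    rw [ContinuousAt, tendsto_iff_norm_sub_tendsto_zero]
    have hn : ∀ y, ‖(hR y).toLp _ - (hR y₀).toLp _‖
        = ∫ t, ‖(c y : ℝ) * u (t * y⁻¹) - (c y₀ : ℝ) * u (t * y₀⁻¹)‖ ∂μ := fun y => by
      rw [L1.norm_eq_integral_norm]
      refine integral_congr_ae ?_
      filter_upwards [Lp.coeFn_sub ((hR y).toLp _) ((hR y₀).toLp _), (hR y).coeFn_toLp,
        (hR y₀).coeFn_toLp] with t h1 h2 h3
      rw [h1, Pi.sub_apply, h2, h3]
    simp_rw [hn]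
    obtain ⟨Y, hY, hYy⟩ := exists_compact_mem_nhds y₀
    have hk : IsCompact (tsupport u * Y) := hus.isCompact.mul hY
    have h : ContinuousOn
        (fun y => ∫ t, ‖(c y : ℝ) * u (t * y⁻¹) - (c y₀ : ℝ) * u (t * y₀⁻¹)‖ ∂μ) Y := by
      refine continuousOn_integral_of_compact_support
        (f := fun y t => ‖(c y : ℝ) * u (t * y⁻¹) - (c y₀ : ℝ) * u (t * y₀⁻¹)‖) hk ?_ ?_
      · refine Continuous.continuousOn ?_
        simp only [Function.uncurry_def]
        fun_prop
      · intro y t hy ht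
        have hz : ∀ z ∈ Y, u (t * z⁻¹) = 0 := fun z hz => by
          by_contra hne
          exact ht ⟨t * z⁻¹, subset_tsupport _ hne, z, hz, by simp⟩
        simp [hz y hy, hz y₀ (mem_of_mem_nhds hYy)]
    have h2 := (h.continuousAt hYy).tendsto
    simpa using h2
  · rw [L1.norm_eq_integral_norm]
    refine le_of_eq ?_
    have h1 : ∫ t, ‖(hR y).toLp _ t‖ ∂μ = ∫ t, ‖(c y : ℝ) * u (t * y⁻¹)‖ ∂μ := by
      refine integral_congr_ae ?_
      filter_upwards [(hR y).coeFn_toLp] with t h2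
      rw [h2]
    rw [h1]
    simp only [norm_mul]
    rw [integral_const_mul]
    have h3 := integral_map (μ := μ) (φ := fun t => t * y) (f := fun t => ‖u (t * y⁻¹)‖)
      (Continuous.aemeasurable (by fun_prop)) (Continuous.aestronglyMeasurable (by fun_prop))
    rw [hcμ y, integral_smul_nnreal_measure, NNReal.smul_def, smul_eq_mul] at h3
    simpa using h3
  · rw [conv_apply, conv_apply]
    have h1 : ∫ t, (hR y).toLp _ t • translate ℝ μ t f ∂μ
        = ∫ t, ((c y : ℝ) * u (t * y⁻¹)) • translate ℝ μ t f ∂μ := by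
      refine integral_congr_ae ?_
      filter_upwards [(hR y).coeFn_toLp] with t h2
      rw [h2]
    have h2 : ∫ t, hu1.toLp u t • translate ℝ μ t (translate ℝ μ y f) ∂μ
        = ∫ t, u t • translate ℝ μ (t * y) f ∂μ := by
      refine integral_congr_ae ?_
      filter_upwards [hu1.coeFn_toLp] with t h2
      rw [h2, translate_mul]
    rw [h1, h2]
    have h3 := hint y (fun t => u (t * y⁻¹) • translate ℝ μ t f)
    simp only [mul_inv_cancel_right] at h3
    rw [h3, ← integral_smul]
    simp only [smul_smul]

end RightTranslation

/-! ### From a mean on `L^∞(G)` to a mean on bounded continuous functions -/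

section Mean

set_option linter.unusedSectionVars false

variable {G : Type u} [Group G] [TopologicalSpace G] [IsTopologicalGroup G]
  [LocallyCompactSpace G] [T2Space G] [MeasurableSpace G] [BorelSpace G]
  {μ : Measure G} [μ.IsHaarMeasure] [μ.Regular]

/-- An invariant mean on `L^∞(G)` restricts to an invariant mean on the bounded continuous
functions. -/
theorem IsAmenable.exists_mean (hG : IsAmenable μ) :
    ∃ m : (G →ᵇ ℝ) →L[ℝ] ℝ, (∀ (f : G →ᵇ ℝ) (δ : ℝ), (∀ x, δ ≤ f x) → δ ≤ m f) ∧
      ∀ (y : G) (f g : G →ᵇ ℝ), (∀ x, g x = f (y * x)) → m g = m f := by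
  obtain ⟨m, hpos, hinv, hone⟩ := hG
  have hmem : ∀ f : G →ᵇ ℝ, MemLp (fun x => (f x : ℂ)) ∞ μ := fun f =>
    memLp_top_of_bound (Continuous.aestronglyMeasurable (by fun_prop)) ‖f‖
      (Eventually.of_forall fun x => by simpa using f.norm_coe_le_norm x)
  have hbound : ∀ f : G →ᵇ ℝ, ‖(hmem f).toLp _‖ ≤ ‖f‖ := fun f => by
    rw [Lp.norm_toLp, eLpNorm_exponent_top]
    exact ENNReal.toReal_le_of_le_ofReal (norm_nonneg f)
      (eLpNormEssSup_le_of_ae_bound (Eventually.of_forall fun x => by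
        simpa using f.norm_coe_le_norm x))
  let l : (G →ᵇ ℝ) →ₗ[ℝ] ℝ :=
    { toFun := fun f => (m ((hmem f).toLp _)).re
      map_add' := fun f g => by
        have : (hmem (f + g)).toLp _ = (hmem f).toLp _ + (hmem g).toLp _ := by
          rw [← MemLp.toLp_add]
          congr 1
          ext x
          simp
        rw [this, map_add, Complex.add_re]
      map_smul' := fun c f => by
        have : (hmem (c • f)).toLp _ = (c : ℂ) • (hmem f).toLp _ := by
          rw [← MemLp.toLp_const_smul]
          congr 1
          ext x
          simp
        rw [this, map_smul]
        simp }
  refine ⟨l.mkContinuous ‖m‖ fun f => ?_, fun f δ hf => ?_, fun y f g hfg => ?_⟩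
  · exact (Complex.abs_re_le_norm _).trans
      ((m.le_opNorm _).trans (mul_le_mul_of_nonneg_left (hbound f) (norm_nonneg _)))
  · have h1 : (hmem (BoundedContinuousFunction.const G δ)).toLp _
        = (δ : ℂ) • (memLp_top_const (1 : ℂ)).toLp (fun _ : G => (1 : ℂ)) := by
      rw [← MemLp.toLp_const_smul]
      congr 1
      ext x
      simp
    have h2 := (hpos ((hmem (f - BoundedContinuousFunction.const G δ)).toLp _) (by
      filter_upwards [(hmem (f - BoundedContinuousFunction.const G δ)).coeFn_toLp] with x hx
      rw [hx]
      simpa using hf x)).1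
    change 0 ≤ l (f - BoundedContinuousFunction.const G δ) at h2
    rw [map_sub] at h2
    have h3 : l (BoundedContinuousFunction.const G δ) = δ := by
      change (m _).re = δ
      rw [h1, map_smul, hone]
      simp
    rw [h3] at h2
    exact sub_nonneg.1 h2
  · change (m _).re = (m _).re
    -- Translation by `t` is `f(t⁻¹x)`, so `x ↦ f(yx)` is the translate by `y⁻¹`.
    rw [← hinv y⁻¹ ((hmem f).toLp _)]
    congr 2
    refine Lp.ext ?_
    refine EventuallyEq.trans ?_ (Lp.coeFn_compMeasurePreserving _
      (measurePreserving_mul_left μ y⁻¹⁻¹)).symm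
    refine (hmem g).coeFn_toLp.trans ?_
    have h := (measurePreserving_mul_left μ y⁻¹⁻¹).quasiMeasurePreserving.ae_eq_comp
      (hmem f).coeFn_toLp
    filter_upwards [h] with x hx
    rw [hx]
    simp [hfg]

end Mean

end WeakAmen

namespace WeakAmen

open scoped BoundedContinuousFunction Pointwise

/-! ### Reiter's condition in `L¹(G)` -/

section Reiter

set_option linter.unusedSectionVars false

variable {G : Type u} [Group G] [TopologicalSpace G] [IsTopologicalGroup G]
  [LocallyCompactSpace G] [T2Space G] [MeasurableSpace G] [BorelSpace G]
  {μ : Measure G} [μ.IsHaarMeasure] [μ.Regular]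

/-- The bounded continuous function `x ↦ φ (u * δ_x * v)`. -/
noncomputable def convCoefficient (φ : Lp ℝ 1 μ →L[ℝ] ℝ) (v : Lp ℝ 1 μ) :
    Lp ℝ 1 μ →L[ℝ] (G →ᵇ ℝ) :=
  have hb : ∀ u x, ‖φ (conv μ u (translate ℝ μ x v))‖ ≤ ‖φ‖ * ‖v‖ * ‖u‖ := fun u x => by
    refine (φ.le_opNorm _).trans ?_
    rw [mul_assoc, mul_comm ‖v‖]
    refine mul_le_mul_of_nonneg_left ((norm_conv_le μ _ _).trans ?_) (norm_nonneg _)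
    rw [LinearIsometry.norm_map]
  LinearMap.mkContinuous
    { toFun := fun u => BoundedContinuousFunction.ofNormedAddCommGroup
        (fun x => φ (conv μ u (translate ℝ μ x v)))
        (φ.continuous.comp ((conv μ u).continuous.comp
          (continuous_translate μ ENNReal.one_ne_top v))) (‖φ‖ * ‖v‖ * ‖u‖) (hb u)
      map_add' := fun u u' => by ext x; simp
      map_smul' := fun c u => by ext x; simp } (‖φ‖ * ‖v‖)
    (fun u => BoundedContinuousFunction.norm_ofNormedAddCommGroup_le _
      (by positivity) (hb u))

theorem convCoefficient_apply (φ : Lp ℝ 1 μ →L[ℝ] ℝ) (u v : Lp ℝ 1 μ) (x : G) :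
    convCoefficient φ v u x = φ (conv μ u (translate ℝ μ x v)) := rfl

variable {m : (G →ᵇ ℝ) →L[ℝ] ℝ}

/-- Since `u * w = ∫ w(y) (u * δ_y) dy`, the function attached to `u * w` is a norm-convergent
integral of those attached to `u * δ_y`, and the mean passes inside. Each of these is the function
attached to `u` with `x` replaced by `yx`, so has the same mean. -/
theorem mean_convCoefficient_conv
    (hm : ∀ (y : G) (f g : G →ᵇ ℝ), (∀ x, g x = f (y * x)) → m g = m f)
    (φ : Lp ℝ 1 μ →L[ℝ] ℝ) (v : Lp ℝ 1 μ) {u : G → ℝ} (hu : Continuous u)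
    (hus : HasCompactSupport u) (hu1 : MemLp u 1 μ) (w : Lp ℝ 1 μ) :
    m (convCoefficient φ v (conv μ (hu1.toLp u) w))
      = m (convCoefficient φ v (hu1.toLp u)) * haarIntegral μ w := by
  obtain ⟨R, C, hRc, hRC, hR⟩ := exists_continuous_conv_translate μ hu hus hu1
  have hint : Integrable (fun y => w y • convCoefficient φ v (R y)) μ :=
    integrable_smul_of_continuous_of_bounded (L1.integrable_coeFn w)
      ((convCoefficient φ v).continuous.comp hRc) (C := ‖convCoefficient φ v‖ * C)
      (fun y => ((convCoefficient φ v).le_opNorm _).trans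
        (mul_le_mul_of_nonneg_left (hRC y) (norm_nonneg _)))
  have h1 : convCoefficient φ v (conv μ (hu1.toLp u) w)
      = ∫ y, w y • convCoefficient φ v (R y) ∂μ := by
    ext x
    have h2 := (BoundedContinuousFunction.evalCLM ℝ x).integral_comp_comm hint
    have h3 := (φ.comp (conv μ (hu1.toLp u))).integral_comp_comm
      (integrable_smul_translate μ w (translate ℝ μ x v))
    refine Eq.trans ?_ h2
    rw [convCoefficient_apply, conv_assoc, conv_apply μ w]
    refine h3.symm.trans (integral_congr_ae (Eventually.of_forall fun y => ?_))
    simp [convCoefficient_apply, hR]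
  rw [h1, ← m.integral_comp_comm hint, haarIntegral_apply, ← integral_const_mul]
  refine integral_congr_ae (Eventually.of_forall fun y => ?_)
  have h2 : m (convCoefficient φ v (R y)) = m (convCoefficient φ v (hu1.toLp u)) :=
    hm y _ _ fun x => by simp only [convCoefficient_apply, hR, translate_mul]
  simp [h2, mul_comm]

/-- With `Λ(w) = m(convCoefficient φ v w)`, the previous lemma makes `∫ u(t) Λ(δ_t * w) dt = Λ(u *
w)` independent of `w` among functions of integral `1`, for `u ∈ C_c(G)`. Hence `d(t) = Λ(δ_t * δ_s
* w) - Λ(δ_t * w)` is orthogonal to every such `u`. Taking `u = b d`, with `b` a bump at `1`, gives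
`∫ b d² = 0` and so `d(1) = 0`. -/
theorem mean_convCoefficient_translate
    (hm : ∀ (y : G) (f g : G →ᵇ ℝ), (∀ x, g x = f (y * x)) → m g = m f)
    (φ : Lp ℝ 1 μ →L[ℝ] ℝ) (v w : Lp ℝ 1 μ) (hw : haarIntegral μ w = 1) (s : G) :
    m (convCoefficient φ v (translate ℝ μ s w)) = m (convCoefficient φ v w) := by
  set Λ : Lp ℝ 1 μ →L[ℝ] ℝ := m.comp (convCoefficient φ v) with hΛ
  have hθ : ∀ w, Continuous fun t => Λ (translate ℝ μ t w) := fun w =>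
    Λ.continuous.comp (continuous_translate μ ENNReal.one_ne_top w)
  set d : G → ℝ := fun t => Λ (translate ℝ μ t (translate ℝ μ s w)) - Λ (translate ℝ μ t w)
    with hd
  have hdc : Continuous d := (hθ _).sub (hθ _)
  by_contra hne
  have hd1 : d 1 ≠ 0 := by
    simp only [hd, translate_one]
    exact sub_ne_zero.2 hne
  obtain ⟨⟨b, hb⟩, hbs, hb0, hb1⟩ : ∃ f : C(G, ℝ), HasCompactSupport f ∧ 0 ≤ f ∧ f 1 ≠ 0 :=
    exists_continuous_nonneg_pos 1
  change HasCompactSupport b at hbs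
  have huc : Continuous fun t => b t * d t := hb.mul hdc
  have hus : HasCompactSupport fun t => b t * d t := hbs.mul_right
  have hu1 : MemLp (fun t => b t * d t) 1 μ := huc.memLp_of_hasCompactSupport hus
  have key : ∀ w : Lp ℝ 1 μ, haarIntegral μ w = 1 →
      ∫ t, b t * d t * Λ (translate ℝ μ t w) ∂μ = Λ (hu1.toLp _) := fun w hw => by
    have h1 := mean_convCoefficient_conv hm φ v huc hus hu1 w
    rw [hw, mul_one] at h1
    change Λ _ = Λ _ at h1
    rw [← h1, conv_apply, ← Λ.integral_comp_comm (integrable_smul_translate μ _ w)]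
    refine integral_congr_ae ?_
    filter_upwards [hu1.coeFn_toLp] with t ht
    rw [ht, map_smul, smul_eq_mul]
  have hi : ∀ w : Lp ℝ 1 μ, Integrable (fun t => b t * d t * Λ (translate ℝ μ t w)) μ := fun w =>
    (huc.mul (hθ w)).integrable_of_hasCompactSupport hus.mul_right
  have h0 : ∫ t, b t * d t * d t ∂μ = 0 := by
    have h2 : (fun t => b t * d t * d t) = fun t =>
        b t * d t * Λ (translate ℝ μ t (translate ℝ μ s w))
          - b t * d t * Λ (translate ℝ μ t w) := by
      funext t
      rw [← mul_sub]
    rw [h2, integral_sub (hi _) (hi _), key _ hw, key _ (by rw [haarIntegral_translate, hw]),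
      sub_self]
  refine absurd h0 (ne_of_gt ?_)
  refine (huc.mul hdc).integral_pos_of_hasCompactSupport_nonneg_nonzero (x := 1)
    hus.mul_right (fun t => ?_) (mul_ne_zero (mul_ne_zero hb1 hd1) hd1)
  change 0 ≤ b t * d t * d t
  rw [mul_assoc]
  exact mul_nonneg (hb0 t) (mul_self_nonneg _)

/-- A convexity argument in the manner of Day and Namioka: all the `s j` are handled at once in a
finite product of copies of `L¹(G)`, where `0` is shown to be a limit of the images of convex
combinations of translates of `v₀`. -/
theorem exists_norm_conv_lt
    (hm0 : ∀ (f : G →ᵇ ℝ) (δ : ℝ), (∀ x, δ ≤ f x) → δ ≤ m f)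
    (hm : ∀ (y : G) (f g : G →ᵇ ℝ), (∀ x, g x = f (y * x)) → m g = m f)
    {v₀ : Lp ℝ 1 μ} (hv₀ : haarIntegral μ v₀ = 1) (hv₁ : ‖v₀‖ ≤ 1)
    {ι : Type*} [Fintype ι] (s : ι → G) {ε : ℝ} (hε : 0 < ε) :
    ∃ v : Lp ℝ 1 μ, ‖v‖ ≤ 1 ∧ haarIntegral μ v = 1 ∧
      ∀ j, ‖conv μ (translate ℝ μ (s j) v₀ - v₀) v‖ < ε := by
  classical
  set D : ι → Lp ℝ 1 μ := fun j => translate ℝ μ (s j) v₀ - v₀ with hD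
  set L : Lp ℝ 1 μ →L[ℝ] (ι → Lp ℝ 1 μ) := ContinuousLinearMap.pi fun j => conv μ (D j) with hL
  set P : Set (Lp ℝ 1 μ) := convexHull ℝ (Set.range fun x => translate ℝ μ x v₀) with hP
  have hP1 : P ⊆ Metric.closedBall 0 1 := convexHull_min
    (by rintro _ ⟨x, rfl⟩; simpa using hv₁) (convex_closedBall _ _)
  have hP2 : P ⊆ {v | haarIntegral μ v = 1} := convexHull_min
    (by rintro _ ⟨x, rfl⟩; simpa [haarIntegral_translate] using hv₀)
    (convex_hyperplane (haarIntegral μ).isBoundedLinearMap.toIsLinearMap 1)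
  have hconv : Convex ℝ (L '' P) := (convex_convexHull ℝ _).linear_image L.toLinearMap
  by_cases h0 : (0 : ι → Lp ℝ 1 μ) ∈ closure (L '' P)
  · obtain ⟨_, ⟨v, hv, rfl⟩, hlt⟩ := Metric.mem_closure_iff.1 h0 ε hε
    rw [dist_zero_left] at hlt
    exact ⟨v, by simpa using hP1 hv, hP2 hv, fun j => (norm_le_pi_norm (L v) j).trans_lt hlt⟩
  · exfalso
    obtain ⟨f, δ, hf0, hf⟩ := geometric_hahn_banach_point_closed hconv.closure isClosed_closure h0
    rw [map_zero] at hf0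
    -- `F(x) = f(L(δ_x * v₀))`, split into components of `f` so that the invariance of the mean
    -- applies to each `D j`.
    set F : G →ᵇ ℝ := ∑ j, convCoefficient
      (f.comp (ContinuousLinearMap.single ℝ (fun _ : ι => Lp ℝ 1 μ) j)) v₀ (D j) with hF
    have hFx : ∀ x, F x = f (L (translate ℝ μ x v₀)) := fun x => by
      rw [hF, BoundedContinuousFunction.sum_apply]
      simp only [convCoefficient_apply, ContinuousLinearMap.comp_apply,
        ContinuousLinearMap.single_apply]
      rw [← map_sum]
      congr 1
      exact Finset.univ_sum_single (L (translate ℝ μ x v₀))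
    have h1 : δ ≤ m F := hm0 F δ fun x => by
      rw [hFx]
      exact (hf _ (subset_closure ⟨_, subset_convexHull ℝ _ ⟨x, rfl⟩, rfl⟩)).le
    have h2 : m F = 0 := by
      rw [hF, map_sum]
      refine Finset.sum_eq_zero fun j _ => ?_
      rw [hD, map_sub, map_sub, mean_convCoefficient_translate hm _ _ _ hv₀, sub_self]
    linarith

theorem exists_haarIntegral_eq_one :
    ∃ v : Lp ℝ 1 μ, haarIntegral μ v = 1 ∧ ‖v‖ ≤ 1 := by
  obtain ⟨⟨b, hb⟩, hbs, hb0, hb1⟩ : ∃ f : C(G, ℝ), HasCompactSupport f ∧ 0 ≤ f ∧ f 1 ≠ 0 :=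
    exists_continuous_nonneg_pos 1
  have hpos : 0 < ∫ t, b t ∂μ := hb.integral_pos_of_hasCompactSupport_nonneg_nonzero hbs hb0 hb1
  have hm : MemLp b 1 μ := hb.memLp_of_hasCompactSupport hbs
  have h1 : haarIntegral μ (hm.toLp b) = ∫ t, b t ∂μ := by
    rw [haarIntegral_apply]
    exact integral_congr_ae hm.coeFn_toLp
  have h2 : ‖hm.toLp b‖ = ∫ t, b t ∂μ := by
    rw [L1.norm_eq_integral_norm]
    refine integral_congr_ae ?_
    filter_upwards [hm.coeFn_toLp] with t ht
    rw [ht, Real.norm_of_nonneg (hb0 t)]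
  refine ⟨(∫ t, b t ∂μ)⁻¹ • hm.toLp b, ?_, ?_⟩
  · rw [map_smul, h1, smul_eq_mul, inv_mul_cancel₀ hpos.ne']
  · rw [norm_smul, h2, Real.norm_of_nonneg (inv_nonneg.2 hpos.le), inv_mul_cancel₀ hpos.ne']

/-- Reiter's condition. -/
theorem IsAmenable.exists_norm_translate_sub_le (hG : IsAmenable μ) {K : Set G}
    (hK : IsCompact K) {ε : ℝ} (hε : 0 < ε) :
    ∃ w : Lp ℝ 1 μ, ‖w‖ = 1 ∧ ∀ s ∈ K, ‖translate ℝ μ s w - w‖ ≤ ε := by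
  obtain ⟨m, hm0, hm⟩ := hG.exists_mean
  obtain ⟨v₀, hv₀, hv₁⟩ := exists_haarIntegral_eq_one (μ := μ)
  have hc := continuous_translate (𝕜 := ℝ) μ ENNReal.one_ne_top v₀
  obtain ⟨T, -, hTK⟩ := hK.elim_nhds_subcover
    (fun s => {t | ‖translate ℝ μ t v₀ - translate ℝ μ s v₀‖ < ε / 2}) (fun s _ => by
      refine (isOpen_lt (by fun_prop) continuous_const).mem_nhds ?_
      simpa using hε)
  obtain ⟨v, hv1, hv2, hv3⟩ := exists_norm_conv_lt hm0 hm hv₀ hv₁ (fun t : T => (t : G))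
    (half_pos hε)
  -- In `w = v₀ * v` translation acts only on `v₀`, so the continuity of `t ↦ δ_t * v₀` controls the
  -- error inside each set of the finite cover uniformly in `v`. The lower bound on `‖w‖` comes from
  -- its integral being `1`.
  refine ⟨conv μ v₀ v, le_antisymm ?_ ?_, fun s hs => ?_⟩
  · exact (norm_conv_le μ _ _).trans (mul_le_one₀ hv₁ (norm_nonneg _) hv1)
  · have h := abs_haarIntegral_le μ (conv μ v₀ v)
    rwa [haarIntegral_conv, hv₀, hv2, mul_one, abs_one] at h
  · obtain ⟨t, ht, hst⟩ := Set.mem_iUnion₂.1 (hTK hs)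
    have h1 : translate ℝ μ s (conv μ v₀ v) - conv μ v₀ v
        = conv μ (translate ℝ μ s v₀ - translate ℝ μ t v₀) v
          + conv μ (translate ℝ μ t v₀ - v₀) v := by
      rw [← conv_translate_left, ← add_apply, ← map_add, sub_add_sub_cancel,
        map_sub, sub_apply]
    rw [h1]
    refine (norm_add_le _ _).trans ?_
    have h2 := (norm_conv_le μ (translate ℝ μ s v₀ - translate ℝ μ t v₀) v).trans
      (mul_le_of_le_one_right (norm_nonneg _) hv1)
    have h3 := hv3 ⟨t, ht⟩
    have h4 : ‖translate ℝ μ s v₀ - translate ℝ μ t v₀‖ < ε / 2 := hst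
    linarith

end Reiter

/-! ### Reiter's condition in `L²(G)` -/

section SquareRoot

variable {G : Type u} [Group G] [TopologicalSpace G] [IsTopologicalGroup G]
  [LocallyCompactSpace G] [T2Space G] [MeasurableSpace G] [BorelSpace G]
  {μ : Measure G} [μ.IsHaarMeasure] [μ.Regular]

theorem sq_sqrt_abs_sub_sqrt_abs_le (x y : ℝ) : (√|x| - √|y|) ^ 2 ≤ |x - y| := by
  have hx := Real.sq_sqrt (abs_nonneg x)
  have hy := Real.sq_sqrt (abs_nonneg y)
  have h1 := Real.sqrt_nonneg |x|
  have h2 := Real.sqrt_nonneg |y|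
  have h3 := abs_sub_abs_le_abs_sub x y
  have h4 := abs_sub_abs_le_abs_sub y x
  rw [abs_sub_comm y x] at h4
  -- If `0 ≤ q ≤ p` then `(p - q)² ≤ p² - q²`.
  rcases le_total √|x| √|y| with h | h <;> nlinarith

theorem L2_norm_sq_eq_integral {α : Type*} {_ : MeasurableSpace α} {μ : Measure α} {H : Type*}
    [NormedAddCommGroup H] [InnerProductSpace ℂ H] (f : Lp H 2 μ) :
    ‖f‖ ^ 2 = ∫ x, ‖f x‖ ^ 2 ∂μ := by
  have h := congrArg Complex.re (L2.inner_def (𝕜 := ℂ) f f)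
  have h' : ∫ x, inner ℂ (f x) (f x) ∂μ = ((∫ x, ‖f x‖ ^ 2 ∂μ : ℝ) : ℂ) := by
    rw [← integral_complex_ofReal]
    refine integral_congr_ae (Eventually.of_forall fun x => ?_)
    simp only [inner_self_eq_norm_sq_to_K]
    norm_cast
  rw [h', Complex.ofReal_re] at h
  rw [← h]
  exact norm_sq_eq_re_inner (𝕜 := ℂ) f

/-- Reiter's condition on `L²`. -/
theorem IsAmenable.exists_norm_leftTranslate_sub_le (hG : IsAmenable μ) {K : Set G}
    (hK : IsCompact K) {ε : ℝ} (hε : 0 < ε) :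
    ∃ ξ : Lp ℂ 2 μ, ‖ξ‖ = 1 ∧ ∀ s ∈ K, ‖leftTranslate μ 2 s ξ - ξ‖ ≤ ε := by
  -- The vector is `√|w|`; its squared `L²` displacement is at most the `L¹` displacement of `w`,
  -- hence the tolerance `ε²`.
  obtain ⟨w, hw1, hw⟩ := hG.exists_norm_translate_sub_le hK (pow_pos hε 2)
  have hmeas : AEStronglyMeasurable (fun x => ((√|w x| : ℝ) : ℂ)) μ :=
    (Continuous.comp_aestronglyMeasurable (g := fun r : ℝ => ((√|r| : ℝ) : ℂ)) (by fun_prop)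
      (Lp.aestronglyMeasurable w))
  have hmem : MemLp (fun x => ((√|w x| : ℝ) : ℂ)) 2 μ := by
    rw [memLp_two_iff_integrable_sq_norm hmeas]
    refine (L1.integrable_coeFn w).norm.congr (Eventually.of_forall fun x => ?_)
    simp [Real.sq_sqrt]
  refine ⟨hmem.toLp _, ?_, fun s hs => ?_⟩
  · have h : ‖hmem.toLp _‖ ^ 2 = 1 := by
      rw [L2_norm_sq_eq_integral, ← hw1, L1.norm_eq_integral_norm]
      refine integral_congr_ae ?_
      filter_upwards [hmem.coeFn_toLp] with x hx
      rw [hx]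
      simp [Real.sq_sqrt]
    exact (pow_eq_one_iff_of_nonneg (norm_nonneg _) two_ne_zero).1 h
  · refine le_of_sq_le_sq ?_ hε.le
    refine le_trans ?_ (hw s hs)
    rw [L2_norm_sq_eq_integral, L1.norm_eq_integral_norm]
    refine integral_mono_of_nonneg (Eventually.of_forall fun x => sq_nonneg _)
      (L1.integrable_coeFn _).norm ?_
    have h1 := (measurePreserving_mul_left μ s⁻¹).quasiMeasurePreserving.ae_eq_comp
      hmem.coeFn_toLp
    filter_upwards [h1, hmem.coeFn_toLp, coeFn_translate (𝕜 := ℝ) μ s w, Lp.coeFn_sub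
      (translate ℝ μ s w) w, Lp.coeFn_sub (leftTranslate μ 2 s (hmem.toLp _)) (hmem.toLp _),
      coeFn_translate (𝕜 := ℂ) μ s (hmem.toLp _)] with x h1 h2 h3 h4 h5 h6
    rw [translate_eq_leftTranslate] at h6
    simp only [Function.comp_apply] at h1
    rw [h4, h5, Pi.sub_apply, Pi.sub_apply, h6, h1, h2, h3, ← Complex.ofReal_sub,
      Complex.norm_real, Real.norm_eq_abs, Real.norm_eq_abs, sq_abs]
    exact sq_sqrt_abs_sub_sqrt_abs_le _ _

end SquareRoot

end WeakAmen

namespace WeakAmen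

/-! ### Fell's absorption principle -/

section Fell

set_option linter.unusedSectionVars false

variable {G : Type u} [Group G] [TopologicalSpace G] [IsTopologicalGroup G]
  [LocallyCompactSpace G] [T2Space G] [MeasurableSpace G] [BorelSpace G]
  (μ : Measure G) [μ.IsHaarMeasure] [μ.Regular]
  {H : Type u} [NormedAddCommGroup H] [InnerProductSpace ℂ H] [CompleteSpace H]

/-- The left regular representation on `L²(G; E)`, as a homomorphism to the unitary group. -/
noncomputable def translateHom (E : Type*) [NormedAddCommGroup E] [InnerProductSpace ℂ E]
    [CompleteSpace E] : G →* unitary (Lp E 2 μ →L[ℂ] Lp E 2 μ) :=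
  Unitary.linearIsometryEquiv.symm.toMonoidHom.comp
    { toFun := fun t =>
        { translate ℂ μ t with
          invFun := translate ℂ μ t⁻¹
          left_inv := fun f => by
            change translate ℂ μ t⁻¹ (translate ℂ μ t f) = f
            rw [← translate_mul, inv_mul_cancel, translate_one]
          right_inv := fun f => by
            change translate ℂ μ t (translate ℂ μ t⁻¹ f) = f
            rw [← translate_mul, mul_inv_cancel, translate_one] }
      map_one' := by
        ext1 f
        exact translate_one μ f
      map_mul' := fun s t => by
        ext1 f
        exact translate_mul μ s t f }

variable (H) in
/-- The left regular representation on `L²(G; H)`. -/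
noncomputable def translateRep : UnitaryRep G (Lp H 2 μ) where
  toHom := translateHom μ H
  continuous_apply := fun ξ => continuous_translate μ ENNReal.ofNat_ne_top ξ

/-- The left regular representation. -/
noncomputable def regularRep : UnitaryRep G (Lp ℂ 2 μ) where
  toHom := translateHom μ ℂ
  continuous_apply := fun ξ => continuous_leftTranslate μ ξ

theorem regularRep_apply (t : G) (ξ : Lp ℂ 2 μ) :
    ((regularRep μ).toHom t : Lp ℂ 2 μ →L[ℂ] Lp ℂ 2 μ) ξ = leftTranslate μ 2 t ξ := rfl

theorem UnitaryRep.norm_apply (π : UnitaryRep G H) (s : G) (ζ : H) :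
    ‖(π.toHom s : H →L[ℂ] H) ζ‖ = ‖ζ‖ := Unitary.norm_map _ _

theorem UnitaryRep.mul_apply (π : UnitaryRep G H) (s t : G) (ζ : H) :
    (π.toHom (s * t) : H →L[ℂ] H) ζ = (π.toHom s : H →L[ℂ] H) ((π.toHom t : H →L[ℂ] H) ζ) := by
  rw [map_mul]
  rfl

theorem UnitaryRep.inner_apply_apply (π : UnitaryRep G H) (s : G) (ζ ζ' : H) :
    inner ℂ ((π.toHom s : H →L[ℂ] H) ζ) ((π.toHom s : H →L[ℂ] H) ζ') = inner ℂ ζ ζ' :=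
  Unitary.inner_map_map _ _ _

theorem memLp_smul_rep (π : UnitaryRep G H) (ζ : H) (η : Lp ℂ 2 μ) :
    MemLp (fun x => η x • (π.toHom x⁻¹ : H →L[ℂ] H) ζ) 2 μ :=
  (Lp.memLp η).of_le_mul (c := ‖ζ‖)
    (aestronglyMeasurable_smul_of_continuous two_ne_zero ENNReal.ofNat_ne_top (Lp.memLp η)
      ((π.continuous_apply ζ).comp continuous_inv))
    (Eventually.of_forall fun x => by rw [norm_smul, π.norm_apply, mul_comm])

/-- The operator `L²(G) → L²(G; H)`, `η ↦ (x ↦ η(x) π(x)⁻¹ ζ)` of Fell's absorption principle. -/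
noncomputable def fell (π : UnitaryRep G H) (ζ : H) : Lp ℂ 2 μ →L[ℂ] Lp H 2 μ :=
  LinearMap.mkContinuous
    { toFun := fun η => (memLp_smul_rep μ π ζ η).toLp _
      map_add' := fun η η' => by
        rw [← MemLp.toLp_add]
        refine MemLp.toLp_congr _ _ ?_
        filter_upwards [Lp.coeFn_add η η'] with x hx
        rw [hx, Pi.add_apply, add_smul]
        rfl
      map_smul' := fun c η => by
        rw [RingHom.id_apply, ← MemLp.toLp_const_smul]
        refine MemLp.toLp_congr _ _ ?_
        filter_upwards [Lp.coeFn_smul c η] with x hx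
        rw [hx, Pi.smul_apply, smul_assoc]
        rfl } ‖ζ‖
    (fun η => Lp.norm_le_mul_norm_of_ae_le_mul (by
      filter_upwards [(memLp_smul_rep μ π ζ η).coeFn_toLp] with x hx
      refine le_of_eq ?_
      change ‖(memLp_smul_rep μ π ζ η).toLp _ x‖ = _
      rw [hx, norm_smul, π.norm_apply, mul_comm]))

theorem coeFn_fell (π : UnitaryRep G H) (ζ : H) (η : Lp ℂ 2 μ) :
    fell μ π ζ η =ᵐ[μ] fun x => η x • (π.toHom x⁻¹ : H →L[ℂ] H) ζ :=
  (memLp_smul_rep μ π ζ η).coeFn_toLp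

theorem norm_fell_le (π : UnitaryRep G H) (ζ : H) : ‖fell μ π ζ‖ ≤ ‖ζ‖ :=
  LinearMap.mkContinuous_norm_le _ (norm_nonneg _) _

/-- At `x` the vectors are `π(x⁻¹)ζ'` and `π(x⁻¹s)ζ`; by unitarity `π(x⁻¹)` cancels, leaving the
constant `⟨ζ', π(s)ζ⟩` to come out of the integral. -/
theorem inner_fell_translate_fell (π : UnitaryRep G H) (ζ ζ' : H) (η η' : Lp ℂ 2 μ) (s : G) :
    inner ℂ (fell μ π ζ' η') (translate ℂ μ s (fell μ π ζ η))
      = inner ℂ ζ' ((π.toHom s : H →L[ℂ] H) ζ) * inner ℂ η' (leftTranslate μ 2 s η) := by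
  rw [L2.inner_def, L2.inner_def, ← integral_const_mul]
  refine integral_congr_ae ?_
  have h := (measurePreserving_mul_left μ s⁻¹).quasiMeasurePreserving.ae_eq_comp
    (coeFn_fell μ π ζ η)
  filter_upwards [coeFn_fell μ π ζ' η', h, coeFn_translate (𝕜 := ℂ) μ s (fell μ π ζ η),
    coeFn_translate (𝕜 := ℂ) μ s η] with x h1 h2 h3 h4
  rw [translate_eq_leftTranslate] at h4
  simp only [Function.comp_apply] at h2
  rw [h1, h3, h2, h4, inner_smul_left, inner_smul_right, mul_inv_rev, inv_inv, π.mul_apply,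
    π.inner_apply_apply]
  simp only [RCLike.inner_apply]
  ring

end Fell

/-! ### Coefficients of `λ` as multipliers of `A(G)` -/

section Multipliers

variable {G : Type u} [Group G] [TopologicalSpace G] [IsTopologicalGroup G]
  [LocallyCompactSpace G] [T2Space G] [MeasurableSpace G] [BorelSpace G]
  (μ : Measure G) [μ.IsHaarMeasure] [μ.Regular]
  {H : Type u} [NormedAddCommGroup H] [InnerProductSpace ℂ H] [CompleteSpace H]

set_option linter.unusedSectionVars false

theorem bNorm_le (π : UnitaryRep G H) (ξ η : H) :
    bNorm (fun s => inner ℂ η ((π.toHom s : H →L[ℂ] H) ξ)) ≤ ‖ξ‖ₑ * ‖η‖ₑ := by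
  unfold bNorm
  exact iInf_le_of_le H (iInf_le_of_le _ (iInf_le_of_le _ (iInf_le_of_le _
    (iInf_le_of_le π (iInf_le_of_le ξ (iInf_le_of_le η (iInf_le_of_le (fun _ => rfl) le_rfl)))))))

theorem bNorm_translate_le (Z Z' : Lp H 2 μ) :
    bNorm (fun s => inner ℂ Z' (translate ℂ μ s Z)) ≤ ‖Z‖ₑ * ‖Z'‖ₑ :=
  bNorm_le (translateRep μ H) Z Z'

/-- The coefficients of the left regular representation on `L²(G; H)` lie in `A(G)`. -/
theorem coefficient_translate_mem_fourierAlgebra (Z Z' : Lp H 2 μ) :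
    (fun s => inner ℂ Z' (translate ℂ μ s Z)) ∈ fourierAlgebra μ := by
  refine ⟨⟨_, _, _, _, translateRep μ H, Z, Z', fun s => rfl⟩, fun ε hε => ?_⟩
  suffices h : ∀ ε : ℝ≥0∞, 0 < ε → ∃ Z₀ : Lp H 2 μ, ‖Z - Z₀‖ₑ < ε ∧
      (fun s => inner ℂ Z' (translate ℂ μ s Z₀)) ∈
        Submodule.span ℂ (regularCoefficients μ) by
    -- The added `1` keeps the divisor nonzero when `Z' = 0`.
    obtain ⟨Z₀, hZ₀, hmem⟩ := h (ε / (‖Z'‖ₑ + 1)) (ENNReal.div_pos hε.ne' (by simp))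
    refine ⟨_, hmem, ?_⟩
    have h1 : ((fun s => inner ℂ Z' (translate ℂ μ s Z)) - fun s =>
        inner ℂ Z' (translate ℂ μ s Z₀)) = fun s => inner ℂ Z' (translate ℂ μ s (Z - Z₀)) := by
      funext s
      simp [inner_sub_right]
    rw [h1]
    refine (bNorm_translate_le μ (Z - Z₀) Z').trans_lt ?_
    have h2 : ‖Z - Z₀‖ₑ * (‖Z'‖ₑ + 1) < ε :=
      (ENNReal.lt_div_iff_mul_lt (Or.inl (by simp)) (Or.inl (by simp))).1 hZ₀
    exact (mul_le_mul_right (le_add_of_nonneg_right zero_le_one) _).trans_lt h2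
  intro ε hε
  let W : Submodule ℂ (Lp H 2 μ) :=
    { carrier := {Z₀ | (fun s => inner ℂ Z' (translate ℂ μ s Z₀)) ∈
        Submodule.span ℂ (regularCoefficients μ)}
      add_mem' := fun {Z₁ Z₂} h₁ h₂ => by
        have : (fun s => inner ℂ Z' (translate ℂ μ s (Z₁ + Z₂))) =
            (fun s => inner ℂ Z' (translate ℂ μ s Z₁)) +
              fun s => inner ℂ Z' (translate ℂ μ s Z₂) := by
          funext s
          simp [inner_add_right]
        simpa only [Set.mem_ofPred_eq, this] using Submodule.add_mem _ h₁ h₂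
      zero_mem' := by
        have : (fun s => inner ℂ Z' (translate ℂ μ s (0 : Lp H 2 μ))) = (0 : G → ℂ) := by
          funext s
          simp
        simp only [Set.mem_ofPred_eq, this, zero_mem]
      smul_mem' := fun c Z₁ h₁ => by
        have : (fun s => inner ℂ Z' (translate ℂ μ s (c • Z₁))) =
            c • fun s => inner ℂ Z' (translate ℂ μ s Z₁) := by
          funext s
          simp [inner_smul_right]
        simpa only [Set.mem_ofPred_eq, this] using Submodule.smul_mem _ c h₁ }
  -- By density it suffices to treat `1_t c`. Its coefficient against `Z'` is that of `1_t` against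
  -- the scalar function `x ↦ ⟨c, Z'(x)⟩`, a coefficient of `λ` itself.
  have hW : ∀ Z₀ : Lp H 2 μ, Z₀ ∈ W.topologicalClosure := by
    refine Lp.induction ENNReal.ofNat_ne_top _ (fun c t ht hμt => ?_)
      (fun f g hf hg _ => Submodule.add_mem _) W.isClosed_topologicalClosure
    refine W.le_topologicalClosure (Submodule.subset_span ?_)
    refine ⟨indicatorConstLp 2 ht hμt.ne (1 : ℂ), ((innerSL ℂ c).compLpL 2 μ) Z', ?_⟩
    funext s
    rw [L2.inner_def, L2.inner_def]
    refine integral_congr_ae ?_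
    have h1 := (measurePreserving_mul_left μ s⁻¹).quasiMeasurePreserving.ae_eq_comp
      (indicatorConstLp_coeFn (p := 2) (hs := ht) (hμs := hμt.ne) (c := c))
    have h2 := (measurePreserving_mul_left μ s⁻¹).quasiMeasurePreserving.ae_eq_comp
      (indicatorConstLp_coeFn (p := 2) (hs := ht) (hμs := hμt.ne) (c := (1 : ℂ)))
    filter_upwards [h1, h2, coeFn_translate (𝕜 := ℂ) μ s (indicatorConstLp 2 ht hμt.ne c),
      coeFn_translate (𝕜 := ℂ) μ s (indicatorConstLp 2 ht hμt.ne (1 : ℂ)),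
      (innerSL ℂ c).coeFn_compLpL (p := 2) Z'] with x h1 h2 h3 h4 h5
    rw [translate_eq_leftTranslate] at h4
    simp only [Function.comp_apply] at h1 h2
    rw [Lp.simpleFunc.coe_indicatorConst, h3, h4, h5, h1, h2]
    by_cases hx : s⁻¹ * x ∈ t <;> simp [hx]
  obtain ⟨Z₀, hZ₀, hlt⟩ := EMetric.mem_closure_iff.1 (hW Z) ε hε
  exact ⟨Z₀, by rwa [edist_eq_enorm_sub] at hlt, hZ₀⟩

/-- The coefficients of the regular representation are multipliers of `A(G)`. -/
theorem isMultiplier_regularCoefficient (ξ η : Lp ℂ 2 μ) :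
    IsMultiplier μ fun s => inner ℂ η (leftTranslate μ 2 s ξ) := by
  -- Only `b ∈ B(G)` is used: a coefficient of `λ` multiplies all of `B(G)` into `A(G)`.
  rintro b ⟨⟨H, _, _, _, π, ζ, ζ', hb⟩, -⟩
  have h : (fun s => inner ℂ η (leftTranslate μ 2 s ξ)) * b =
      fun s => inner ℂ (fell μ π ζ' η) (translate ℂ μ s (fell μ π ζ ξ)) := by
    funext s
    rw [Pi.mul_apply, hb, inner_fell_translate_fell, mul_comm]
  rw [h]
  exact coefficient_translate_mem_fourierAlgebra μ _ _

end Multipliers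

end WeakAmen

namespace WeakAmen

/-! ### Amplifications `1 ⊗ T` and complete contractivity of `T ↦ U*(1 ⊗ T)U` -/

section Amplification

set_option linter.unusedSectionVars false

variable {E : Type u} [NormedAddCommGroup E] [InnerProductSpace ℂ E] {ι : Type*}

/-- The Hilbert sum of copies of `E` indexed by `ι`. -/
abbrev Ell2 (ι : Type*) (E : Type*) [NormedAddCommGroup E] := lp (fun _ : ι => E) 2

theorem Ell2.summable_norm_sq (f : Ell2 ι E) : Summable fun i => ‖f i‖ ^ 2 := by
  simpa using (lp.memℓp f).summable (by simp)

theorem Ell2.norm_sq_eq_tsum (f : Ell2 ι E) : ‖f‖ ^ 2 = ∑' i, ‖f i‖ ^ 2 := by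
  simpa using lp.norm_rpow_eq_tsum (p := 2) (by simp) f

/-- The element of the Hilbert sum given by a square summable family. -/
def Ell2.mk (f : ι → E) (hf : Summable fun i => ‖f i‖ ^ 2) : Ell2 ι E :=
  ⟨f, memℓp_gen (by simpa using hf)⟩

theorem Ell2.summable_apply (T : E →L[ℂ] E) (f : Ell2 ι E) :
    Summable fun i => ‖T (f i)‖ ^ 2 := by
  refine Summable.of_nonneg_of_le (fun i => sq_nonneg _) (fun i => ?_)
    ((Ell2.summable_norm_sq f).mul_left (‖T‖ ^ 2))
  rw [← mul_pow]
  exact pow_le_pow_left₀ (norm_nonneg _) (T.le_opNorm _) 2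

/-- The amplification of an operator to a Hilbert sum, acting coordinatewise. -/
noncomputable def amp (ι : Type*) (T : E →L[ℂ] E) : Ell2 ι E →L[ℂ] Ell2 ι E :=
  LinearMap.mkContinuous
    { toFun := fun f => Ell2.mk (fun i => T (f i)) (Ell2.summable_apply T f)
      map_add' := fun f g => by
        ext i
        exact map_add T _ _
      map_smul' := fun c f => by
        ext i
        exact map_smul T _ _ } ‖T‖
    (fun f => by
      refine le_of_sq_le_sq ?_ (by positivity)
      rw [Ell2.norm_sq_eq_tsum, mul_pow, Ell2.norm_sq_eq_tsum, ← tsum_mul_left]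
      refine (Ell2.summable_apply T f).tsum_le_tsum (fun i => ?_)
        ((Ell2.summable_norm_sq f).mul_left _)
      rw [← mul_pow]
      exact pow_le_pow_left₀ (norm_nonneg _) (T.le_opNorm _) 2)

@[simp]
theorem amp_apply (T : E →L[ℂ] E) (f : Ell2 ι E) (i : ι) : amp ι T f i = T (f i) := rfl

theorem amp_add (S T : E →L[ℂ] E) : amp ι (S + T) = amp ι S + amp ι T := by
  ext f i
  rfl

theorem amp_smul (c : ℂ) (T : E →L[ℂ] E) : amp ι (c • T) = c • amp ι T := by
  ext f i
  rfl

theorem amp_single [DecidableEq ι] (T : E →L[ℂ] E) (i : ι) (y : E) :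
    amp ι T (lp.single 2 i y) = lp.single 2 i (T y) := by
  ext j : 2
  rw [amp_apply]
  rcases eq_or_ne j i with rfl | hj
  · rw [lp.single_apply_self, lp.single_apply_self]
  · rw [lp.single_apply_ne _ _ _ hj, lp.single_apply_ne _ _ _ hj, map_zero]

/-- An amplified operator commutes with a matrix of operators if it commutes with its entries. -/
theorem comp_amp_eq_amp_comp [DecidableEq ι] (P : Ell2 ι E →L[ℂ] Ell2 ι E) (T : E →L[ℂ] E)
    (h : ∀ i k y, P (lp.single 2 i (T y)) k = T (P (lp.single 2 i y) k)) :
    P ∘L amp ι T = amp ι T ∘L P := by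
  refine lp.ext_continuousLinearMap (by simp) fun i => ?_
  ext1 y
  ext k : 2
  change P (amp ι T (lp.single 2 i y)) k = T (P (lp.single 2 i y) k)
  rw [amp_single, h]

theorem mem_topologicalClosure_of_invariant {𝓗 : Type*} [NormedAddCommGroup 𝓗]
    [InnerProductSpace ℂ 𝓗] (V : Submodule ℂ 𝓗) (A : 𝓗 →L[ℂ] 𝓗) (hA : ∀ v ∈ V, A v ∈ V) (v : 𝓗)
    (hv : v ∈ V.topologicalClosure) : A v ∈ V.topologicalClosure :=
  map_mem_closure A.continuous hv hA

/-- The projection onto a subspace that is invariant under an operator and its adjoint commutes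
with the operator. -/
theorem starProjection_comm_of_invariant {𝓗 : Type*} [NormedAddCommGroup 𝓗]
    [InnerProductSpace ℂ 𝓗] (V : Submodule ℂ 𝓗) [V.HasOrthogonalProjection] (A B : 𝓗 →L[ℂ] 𝓗)
    (hAB : ∀ u v, inner ℂ (B u) v = inner ℂ u (A v)) (hA : ∀ v ∈ V, A v ∈ V)
    (hB : ∀ v ∈ V, B v ∈ V) (v : 𝓗) : V.starProjection (A v) = A (V.starProjection v) := by
  refine Submodule.eq_starProjection_of_mem_orthogonal
    (hA _ (Submodule.starProjection_apply_mem _ _)) ?_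
  rw [← map_sub]
  refine (Submodule.mem_orthogonal _ _).2 fun u hu => ?_
  rw [← hAB]
  exact (Submodule.mem_orthogonal _ _).1 (V.sub_starProjection_mem_orthogonal v) _ (hB u hu)

variable [CompleteSpace E]

/-- The completely positive map `T ↦ U* (1 ⊗ T) U`. -/
noncomputable def krausMap (U : E →L[ℂ] Ell2 ι E) : (E →L[ℂ] E) →ₗ[ℂ] (E →L[ℂ] E) where
  toFun T := U.adjoint ∘L amp ι T ∘L U
  map_add' S T := by
    rw [amp_add, ContinuousLinearMap.add_comp, ContinuousLinearMap.comp_add]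
  map_smul' c T := by
    rw [amp_smul, ContinuousLinearMap.smul_comp, ContinuousLinearMap.comp_smul, RingHom.id_apply]

theorem krausMap_apply (U : E →L[ℂ] Ell2 ι E) (T : E →L[ℂ] E) (η : E) :
    krausMap U T η = U.adjoint (amp ι T (U η)) := rfl

theorem inner_krausMap (U : E →L[ℂ] Ell2 ι E) (T : E →L[ℂ] E) (η η' : E) :
    inner ℂ η' (krausMap U T η) = ∑' i, inner ℂ (U η' i) (T (U η i)) := by
  rw [krausMap_apply, ContinuousLinearMap.adjoint_inner_right]
  rfl

theorem norm_adjoint_apply_le {U : E →L[ℂ] Ell2 ι E} (hU : ‖U‖ ≤ 1) (f : Ell2 ι E) :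
    ‖U.adjoint f‖ ≤ ‖f‖ := by
  refine (U.adjoint.le_opNorm f).trans (mul_le_of_le_one_left (norm_nonneg _) ?_)
  rwa [LinearIsometryEquiv.norm_map]

theorem matrixOp_apply {n : ℕ} (x : Fin n → Fin n → E →L[ℂ] E)
    (ζ : PiLp 2 (fun _ : Fin n => E)) (i : Fin n) : matrixOp x ζ i = ∑ j, x i j (ζ j) := by
  simp [matrixOp]

/-- The matrix `(1 ⊗ x i j)` acts on each coordinate `k` of the Hilbert sum as `matrixOp x`, so it
is a contraction after interchanging the sums over `i` and `k`; applying `U` and `U*` entrywise does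
not increase norms. -/
theorem norm_matrixOp_krausMap_le {U : E →L[ℂ] Ell2 ι E} (hU : ‖U‖ ≤ 1) {n : ℕ}
    (x : Fin n → Fin n → E →L[ℂ] E) (hx : ‖matrixOp x‖ ≤ 1) :
    ‖matrixOp fun i j => krausMap U (x i j)‖ ≤ 1 := by
  refine ContinuousLinearMap.opNorm_le_bound _ zero_le_one fun ζ => ?_
  rw [one_mul]
  refine le_of_sq_le_sq ?_ (norm_nonneg _)
  have hy : ∀ i k, (∑ j, amp ι (x i j) (U (ζ j))) k = ∑ j, x i j (U (ζ j) k) := fun i k => by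
    rw [lp.coeFn_sum, Finset.sum_apply]
    rfl
  have hs : ∀ i, Summable fun k => ‖∑ j, x i j (U (ζ j) k)‖ ^ 2 := fun i => by
    simpa only [hy] using Ell2.summable_norm_sq (∑ j, amp ι (x i j) (U (ζ j)))
  calc ‖(matrixOp fun i j => krausMap U (x i j)) ζ‖ ^ 2
      = ∑ i, ‖U.adjoint (∑ j, amp ι (x i j) (U (ζ j)))‖ ^ 2 := by
        rw [PiLp.norm_sq_eq_of_L2]
        simp only [matrixOp_apply, krausMap_apply, map_sum]
    _ ≤ ∑ i, ‖∑ j, amp ι (x i j) (U (ζ j))‖ ^ 2 :=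
        Finset.sum_le_sum fun i _ =>
          pow_le_pow_left₀ (norm_nonneg _) (norm_adjoint_apply_le hU _) 2
    _ = ∑' k, ∑ i, ‖∑ j, x i j (U (ζ j) k)‖ ^ 2 := by
        rw [Summable.tsum_finsetSum fun i _ => hs i]
        simp only [Ell2.norm_sq_eq_tsum, hy]
    _ ≤ ∑' k, ∑ j, ‖U (ζ j) k‖ ^ 2 := by
        refine Summable.tsum_le_tsum (fun k => ?_) (summable_sum fun i _ => hs i)
          (summable_sum fun j _ => Ell2.summable_norm_sq _)
        have h := pow_le_pow_left₀ (norm_nonneg _)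
          (((matrixOp x).le_opNorm (WithLp.toLp 2 fun j => U (ζ j) k)).trans
            (mul_le_of_le_one_left (norm_nonneg _) hx)) 2
        rw [PiLp.norm_sq_eq_of_L2, PiLp.norm_sq_eq_of_L2] at h
        simpa only [matrixOp_apply] using h
    _ = ∑ j, ‖U (ζ j)‖ ^ 2 := by
        rw [Summable.tsum_finsetSum fun j _ => Ell2.summable_norm_sq _]
        simp only [Ell2.norm_sq_eq_tsum]
    _ ≤ ∑ j, ‖ζ j‖ ^ 2 := Finset.sum_le_sum fun j _ => pow_le_pow_left₀ (norm_nonneg _)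
        ((U.le_opNorm _).trans (mul_le_of_le_one_left (norm_nonneg _) hU)) 2
    _ = ‖ζ‖ ^ 2 := (PiLp.norm_sq_eq_of_L2 _ _).symm

theorem cbNorm_le_one {S : Submodule ℂ (E →L[ℂ] E)} {u : S →ₗ[ℂ] S} {U : E →L[ℂ] Ell2 ι E}
    (hU : ‖U‖ ≤ 1) (hu : ∀ T : S, (u T : E →L[ℂ] E) = krausMap U T) : cbNorm u ≤ 1 := by
  refine iSup_le fun n => iSup_le fun x => iSup_le fun hx => ?_
  have h := norm_matrixOp_krausMap_le hU (fun i j => (x i j : E →L[ℂ] E)) hx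
  simp only [hu]
  rw [← ofReal_norm]
  exact ENNReal.ofReal_le_one.2 h

end Amplification

/-! ### Ultraweak continuity of `T ↦ U*(1 ⊗ T)U` -/

section Ultraweak

variable {E : Type u} [NormedAddCommGroup E] [InnerProductSpace ℂ E]

/-- Square summable families of vectors over any index set can be replaced by sequences. -/
theorem exists_nat_tsum_inner_eq {α : Type*} {f g : α → E} (hf : Summable fun a => ‖f a‖ ^ 2)
    (hg : Summable fun a => ‖g a‖ ^ 2) :
    ∃ f' g' : ℕ → E, (Summable fun n => ‖f' n‖ ^ 2) ∧ (Summable fun n => ‖g' n‖ ^ 2) ∧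
      ∀ T : E →L[ℂ] E, ∑' a, inner ℂ (g a) (T (f a)) = ∑' n, inner ℂ (g' n) (T (f' n)) := by
  -- A square summable family has countable support, and terms with `f a = 0` contribute nothing, so
  -- `g` may be cut down to the support of `f`.
  set s : Set α := Function.support fun a => ‖f a‖ ^ 2 with hs
  have : Countable s := hf.countable_support.to_subtype
  obtain ⟨e, he⟩ := exists_injective_nat s
  have hex : ∀ h : α → E, (Summable fun a => ‖h a‖ ^ 2) →
      Summable fun n => ‖Function.extend e (fun a : s => h a) 0 n‖ ^ 2 := fun h hh => by
    refine (he.summable_iff fun n hn => ?_).1 ?_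
    · rw [Function.extend_apply' _ _ _ (by simpa using hn)]
      simp
    · have : ((fun n => ‖Function.extend e (fun a : s => h a) 0 n‖ ^ 2) ∘ e)
          = fun a : s => ‖h a‖ ^ 2 := by
        funext a
        simp [he.extend_apply]
      rw [this]
      exact hh.subtype s
  refine ⟨_, _, hex f hf, hex g hg, fun T => ?_⟩
  have h1 : ∑' a : s, inner ℂ (g a) (T (f a)) = ∑' a, inner ℂ (g a) (T (f a)) :=
    tsum_subtype_eq_of_support_subset (f := fun a => inner ℂ (g a) (T (f a))) fun a ha => by
      rw [Function.mem_support] at ha ⊢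
      contrapose! ha
      have : f a = 0 := by simpa using ha
      simp [this]
  have h2 := he.tsum_eq (f := fun n => inner ℂ (Function.extend e (fun a : s => g a) 0 n)
    (T (Function.extend e (fun a : s => f a) 0 n))) fun n hn => by
      by_contra hne
      rw [Function.mem_support, Function.extend_apply' _ _ _ (by simpa using hne)] at hn
      simp at hn
  rw [← h1, ← h2]
  refine tsum_congr fun a => ?_
  rw [he.extend_apply, he.extend_apply]

variable [CompleteSpace E] {ι : Type*}

/-- Composing the functional of `(ξ, η)` with `u` gives the functional of the families `(U ξ_k)_i`,
`(U η_k)_i` over `ℕ × ι`, which are again square summable and can be reindexed by `ℕ`. -/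
theorem continuous_ultraweak_of_eq_krausMap {S : Submodule ℂ (E →L[ℂ] E)} {u : S →ₗ[ℂ] S}
    {U : E →L[ℂ] Ell2 ι E} (hu : ∀ T : S, (u T : E →L[ℂ] E) = krausMap U T) :
    Continuous[ultraweak S, ultraweak S] u := by
  let := ultraweak S
  refine continuous_induced_rng.2 (continuous_pi fun y => ?_)
  obtain ⟨⟨ξ, η⟩, hξ, hη⟩ := y
  have hsum : ∀ ξ : ℕ → E, (Summable fun k => ‖ξ k‖ ^ 2) →
      Summable fun p : ℕ × ι => ‖U (ξ p.1) p.2‖ ^ 2 := fun ξ hξ => by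
    refine (summable_prod_of_nonneg fun p => sq_nonneg _).2
      ⟨fun n => Ell2.summable_norm_sq (U (ξ n)), ?_⟩
    refine Summable.of_nonneg_of_le (fun n => tsum_nonneg fun k => sq_nonneg _) (fun n => ?_)
      (hξ.mul_left (‖U‖ ^ 2))
    rw [← mul_pow]
    change ∑' k, ‖U (ξ n) k‖ ^ 2 ≤ _
    rw [← Ell2.norm_sq_eq_tsum]
    exact pow_le_pow_left₀ (norm_nonneg _) (U.le_opNorm _) 2
  obtain ⟨ξ', η', hξ', hη', h⟩ := exists_nat_tsum_inner_eq (hsum ξ hξ) (hsum η hη)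
  have key : ∀ T : S, ∑' k, inner ℂ (η k) ((u T : E →L[ℂ] E) (ξ k))
      = ∑' n, inner ℂ (η' n) ((T : E →L[ℂ] E) (ξ' n)) := fun T => by
    rw [← h]
    have hs : Summable fun p : ℕ × ι =>
        inner ℂ (U (η p.1) p.2) ((T : E →L[ℂ] E) (U (ξ p.1) p.2)) := by
      refine Summable.of_norm_bounded
        (((hsum ξ hξ).add (hsum η hη)).mul_left ‖(T : E →L[ℂ] E)‖) fun p => ?_
      refine (norm_inner_le_norm _ _).trans ?_
      have h1 := (T : E →L[ℂ] E).le_opNorm (U (ξ p.1) p.2)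
      have h2 : ‖U (η p.1) p.2‖ * ‖U (ξ p.1) p.2‖
          ≤ ‖U (ξ p.1) p.2‖ ^ 2 + ‖U (η p.1) p.2‖ ^ 2 := by
        nlinarith [sq_nonneg (‖U (ξ p.1) p.2‖ - ‖U (η p.1) p.2‖),
          sq_nonneg ‖U (ξ p.1) p.2‖, sq_nonneg ‖U (η p.1) p.2‖]
      calc _ ≤ ‖U (η p.1) p.2‖ * (‖(T : E →L[ℂ] E)‖ * ‖U (ξ p.1) p.2‖) :=
            mul_le_mul_of_nonneg_left h1 (norm_nonneg _)
        _ = ‖(T : E →L[ℂ] E)‖ * (‖U (η p.1) p.2‖ * ‖U (ξ p.1) p.2‖) := by ring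
        _ ≤ _ := mul_le_mul_of_nonneg_left h2 (norm_nonneg _)
    rw [hs.tsum_prod]
    exact tsum_congr fun k => by rw [hu, inner_krausMap]
  have hΦ : Continuous fun (T : S) (y : {y : (ℕ → E) × (ℕ → E) //
        (Summable fun k => ‖y.1 k‖ ^ 2) ∧ (Summable fun k => ‖y.2 k‖ ^ 2)}) =>
      ∑' k, inner ℂ (y.1.2 k) ((T : E →L[ℂ] E) (y.1.1 k)) := continuous_induced_dom
  exact (continuous_pi_iff.1 hΦ ⟨(ξ', η'), hξ', hη'⟩).congr fun T => (key T).symm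

end Ultraweak

end WeakAmen

namespace WeakAmen

/-! ### Ultrastrong density of `λ(L¹(G))` in `LG` -/

section Density

set_option linter.unusedSectionVars false

variable {G : Type u} [Group G] [TopologicalSpace G] [IsTopologicalGroup G]
  [LocallyCompactSpace G] [T2Space G] [MeasurableSpace G] [BorelSpace G]
  {μ : Measure G} [μ.IsHaarMeasure] [μ.Regular] {ι : Type*}

theorem regularL1_apply (g : Lp ℂ 1 μ) (ξ : Lp ℂ 2 μ) :
    regularL1 μ g ξ = ∫ s, g s • leftTranslate μ 2 s ξ ∂μ := rfl

/-- Elements of the group von Neumann algebra commute with the operators that commute with all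
left translations. -/
theorem commute_of_mem_groupVN {T : Lp ℂ 2 μ →L[ℂ] Lp ℂ 2 μ} (hT : T ∈ groupVN μ)
    (B : Lp ℂ 2 μ →L[ℂ] Lp ℂ 2 μ)
    (hB : ∀ s ξ, B (leftTranslate μ 2 s ξ) = leftTranslate μ 2 s (B ξ)) (ξ : Lp ℂ 2 μ) :
    T (B ξ) = B (T ξ) := by
  rw [mem_groupVN_iff] at hT
  have hcl : IsClosed {F : Lp ℂ 2 μ → Lp ℂ 2 μ | F (B ξ) = B (F ξ)} :=
    isClosed_eq (continuous_apply _) (B.continuous.comp (continuous_apply _))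
  refine closure_minimal ?_ hcl hT
  rintro _ ⟨g, rfl⟩
  change regularL1 μ g (B ξ) = B (regularL1 μ g ξ)
  rw [regularL1_apply, regularL1_apply, ← B.integral_comp_comm
    (integrable_smul_leftTranslate μ (L1.integrable_coeFn g) ξ)]
  refine integral_congr_ae (Eventually.of_forall fun s => ?_)
  simp only [map_smul, hB]

theorem regularL1_translate (t : G) (g : Lp ℂ 1 μ) (ξ : Lp ℂ 2 μ) :
    regularL1 μ (translate ℂ μ t g) ξ = leftTranslate μ 2 t (regularL1 μ g ξ) := by
  rw [regularL1_apply, regularL1_apply]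
  have h1 : ∫ s, translate ℂ μ t g s • leftTranslate μ 2 s ξ ∂μ
      = ∫ s, g (t⁻¹ * s) • leftTranslate μ 2 s ξ ∂μ := by
    refine integral_congr_ae ?_
    filter_upwards [coeFn_translate (𝕜 := ℂ) μ t g] with s hs
    rw [hs]
  have h2 := (leftTranslate μ 2 t).toContinuousLinearMap.integral_comp_comm
    (integrable_smul_leftTranslate μ (L1.integrable_coeFn g) ξ)
  rw [h1, ← integral_mul_left_eq_self _ t]
  refine Eq.trans ?_ h2
  refine integral_congr_ae (Eventually.of_forall fun s => ?_)
  simp [← translate_eq_leftTranslate, translate_mul]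

/-- The amplified left translations. -/
noncomputable def ampTranslate (μ : Measure G) [μ.IsHaarMeasure] (ι : Type*) (s : G) :
    Ell2 ι (Lp ℂ 2 μ) →L[ℂ] Ell2 ι (Lp ℂ 2 μ) :=
  amp ι (leftTranslate μ 2 s).toContinuousLinearMap

theorem ampTranslate_apply (s : G) (ω : Ell2 ι (Lp ℂ 2 μ)) (i : ι) :
    ampTranslate μ ι s ω i = leftTranslate μ 2 s (ω i) := rfl

theorem ampTranslate_mul (s t : G) (ω : Ell2 ι (Lp ℂ 2 μ)) :
    ampTranslate μ ι (s * t) ω = ampTranslate μ ι s (ampTranslate μ ι t ω) := by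
  ext i : 2
  exact translate_mul μ s t (ω i)

theorem ampTranslate_one (ω : Ell2 ι (Lp ℂ 2 μ)) : ampTranslate μ ι 1 ω = ω := by
  ext i : 2
  exact translate_one μ (ω i)

theorem inner_ampTranslate (s : G) (ω ω' : Ell2 ι (Lp ℂ 2 μ)) :
    inner ℂ (ampTranslate μ ι s ω) (ampTranslate μ ι s ω') = inner ℂ ω ω' := by
  rw [lp.inner_eq_tsum, lp.inner_eq_tsum]
  exact tsum_congr fun i => (leftTranslate μ 2 s).inner_map_map _ _

theorem inner_ampTranslate_inv (s : G) (ω ω' : Ell2 ι (Lp ℂ 2 μ)) :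
    inner ℂ (ampTranslate μ ι s⁻¹ ω) ω' = inner ℂ ω (ampTranslate μ ι s ω') := by
  rw [← inner_ampTranslate s, ← ampTranslate_mul, mul_inv_cancel, ampTranslate_one]

theorem norm_ampTranslate (s : G) (ω : Ell2 ι (Lp ℂ 2 μ)) : ‖ampTranslate μ ι s ω‖ = ‖ω‖ := by
  refine (sq_eq_sq₀ (norm_nonneg _) (norm_nonneg _)).1 ?_
  rw [Ell2.norm_sq_eq_tsum, Ell2.norm_sq_eq_tsum]
  simp only [ampTranslate_apply, LinearIsometry.norm_map]

theorem continuous_ampTranslate (ω : Ell2 ι (Lp ℂ 2 μ)) :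
    Continuous fun s => ampTranslate μ ι s ω := by
  refine continuous_iff_continuousAt.2 fun s₀ => ?_
  rw [ContinuousAt, tendsto_iff_norm_sub_tendsto_zero]
  have hc : Continuous fun s =>
      ∑' i, ‖leftTranslate μ 2 s (ω i) - leftTranslate μ 2 s₀ (ω i)‖ ^ 2 := by
    -- Each displacement has norm at most `2‖ω i‖`, whence the dominating factor `4`.
    refine continuous_tsum (fun i => ?_) ((Ell2.summable_norm_sq ω).mul_left 4) fun i s => ?_
    · exact (((continuous_leftTranslate μ (ω i)).sub continuous_const).norm).pow 2
    · rw [Real.norm_of_nonneg (sq_nonneg _)]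
      have h := norm_sub_le (leftTranslate μ 2 s (ω i)) (leftTranslate μ 2 s₀ (ω i))
      rw [LinearIsometry.norm_map, LinearIsometry.norm_map] at h
      nlinarith [norm_nonneg (leftTranslate μ 2 s (ω i) - leftTranslate μ 2 s₀ (ω i)),
        norm_nonneg (ω i)]
  have h0 : Continuous fun s => ‖ampTranslate μ ι s ω - ampTranslate μ ι s₀ ω‖ := by
    refine (Real.continuous_sqrt.comp hc).congr fun s => ?_
    rw [Function.comp_apply, ← Real.sqrt_sq (norm_nonneg (ampTranslate μ ι s ω - _)),
      Ell2.norm_sq_eq_tsum]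
    rfl
  simpa using h0.tendsto s₀

theorem integrable_smul_ampTranslate (g : Lp ℂ 1 μ) (ω : Ell2 ι (Lp ℂ 2 μ)) :
    Integrable (fun s => g s • ampTranslate μ ι s ω) μ :=
  integrable_smul_of_continuous_of_bounded (L1.integrable_coeFn g) (continuous_ampTranslate ω)
    fun s => (norm_ampTranslate s ω).le

theorem amp_regularL1_apply (g : Lp ℂ 1 μ) (ω : Ell2 ι (Lp ℂ 2 μ)) :
    amp ι (regularL1 μ g) ω = ∫ s, g s • ampTranslate μ ι s ω ∂μ := by
  ext i : 2
  exact (lp.evalCLM ℂ (fun _ : ι => Lp ℂ 2 μ) 2 i).integral_comp_comm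
    (integrable_smul_ampTranslate g ω)

/-- Nondegeneracy of the regular representation of `L¹(G)`. -/
theorem exists_norm_amp_regularL1_sub_le (ω : Ell2 ι (Lp ℂ 2 μ)) {ε : ℝ} (hε : 0 < ε) :
    ∃ g : Lp ℂ 1 μ, ‖amp ι (regularL1 μ g) ω - ω‖ ≤ ε := by
  have hU : {s | ‖ampTranslate μ ι s ω - ω‖ < ε} ∈ 𝓝 (1 : G) := by
    refine (isOpen_lt ((continuous_ampTranslate ω).sub continuous_const).norm
      continuous_const).mem_nhds ?_
    simpa [ampTranslate_one] using hε
  obtain ⟨K, hK, hKU, hKc⟩ := local_compact_nhds hU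
  have hKm : MeasurableSet K := hKc.isClosed.measurableSet
  have hKtop : μ K ≠ ∞ := hKc.measure_ne_top
  have hK0 : μ K ≠ 0 := (Measure.measure_pos_of_mem_nhds μ hK).ne'
  have hpos : 0 < μ.real K := ENNReal.toReal_pos hK0 hKtop
  -- The normalised indicator of a compact neighbourhood of `1` averages vectors lying within `ε` of
  -- `ω`.
  refine ⟨indicatorConstLp 1 hKm hKtop (((μ.real K)⁻¹ : ℝ) : ℂ), ?_⟩
  have h1 : amp ι (regularL1 μ (indicatorConstLp 1 hKm hKtop (((μ.real K)⁻¹ : ℝ) : ℂ))) ω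
      = ∫ s in K, (((μ.real K)⁻¹ : ℝ) : ℂ) • ampTranslate μ ι s ω ∂μ := by
    rw [amp_regularL1_apply, ← integral_indicator hKm]
    refine integral_congr_ae ?_
    filter_upwards [indicatorConstLp_coeFn (p := 1) (hs := hKm) (hμs := hKtop)
      (c := (((μ.real K)⁻¹ : ℝ) : ℂ))] with s hs
    rw [hs]
    by_cases h : s ∈ K <;> simp [h]
  have h2 : ω = ∫ s in K, (((μ.real K)⁻¹ : ℝ) : ℂ) • ω ∂μ := by
    rw [setIntegral_const, RCLike.real_smul_eq_coe_smul (K := ℂ), smul_smul]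
    simp [hpos.ne']
  have hi : IntegrableOn (fun s => (((μ.real K)⁻¹ : ℝ) : ℂ) • ampTranslate μ ι s ω) K μ :=
    Integrable.smul (((μ.real K)⁻¹ : ℝ) : ℂ)
      ((continuous_ampTranslate ω).continuousOn.integrableOn_compact hKc)
  have h3 : amp ι (regularL1 μ (indicatorConstLp 1 hKm hKtop (((μ.real K)⁻¹ : ℝ) : ℂ))) ω - ω
      = ∫ s in K, (((μ.real K)⁻¹ : ℝ) : ℂ) • (ampTranslate μ ι s ω - ω) ∂μ := by
    rw [h1]
    nth_rewrite 2 [h2]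
    rw [← integral_sub hi (integrableOn_const hKtop)]
    simp only [smul_sub]
  rw [h3]
  refine (norm_setIntegral_le_of_norm_le_const (C := (μ.real K)⁻¹ * ε) hKtop.lt_top
    fun s hs => ?_).trans (le_of_eq ?_)
  · rw [norm_smul, Complex.norm_real, Real.norm_of_nonneg (inv_nonneg.2 hpos.le)]
    exact mul_le_mul_of_nonneg_left (le_of_lt (hKU hs)) (inv_nonneg.2 hpos.le)
  · field_simp

/-- The map `g ↦ (1 ⊗ λ(g)) ω`. -/
noncomputable def orbitMap (ω : Ell2 ι (Lp ℂ 2 μ)) : Lp ℂ 1 μ →ₗ[ℂ] Ell2 ι (Lp ℂ 2 μ) where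
  toFun g := amp ι (regularL1 μ g) ω
  map_add' g g' := by
    rw [map_add, amp_add]
    rfl
  map_smul' c g := by
    rw [map_smul, amp_smul]
    rfl

theorem orbitMap_apply (ω : Ell2 ι (Lp ℂ 2 μ)) (g : Lp ℂ 1 μ) :
    orbitMap ω g = amp ι (regularL1 μ g) ω := rfl

theorem orbitMap_translate (ω : Ell2 ι (Lp ℂ 2 μ)) (s : G) (g : Lp ℂ 1 μ) :
    orbitMap ω (translate ℂ μ s g) = ampTranslate μ ι s (orbitMap ω g) := by
  ext i : 2
  rw [orbitMap_apply, orbitMap_apply, ampTranslate_apply, amp_apply, amp_apply,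
    regularL1_translate]

/-- The cyclic subspace of the amplified regular representation generated by `ω`. -/
noncomputable def cyclicSubspace (ω : Ell2 ι (Lp ℂ 2 μ)) : Submodule ℂ (Ell2 ι (Lp ℂ 2 μ)) :=
  (LinearMap.range (orbitMap ω)).topologicalClosure

instance completeSpace_cyclicSubspace (ω : Ell2 ι (Lp ℂ 2 μ)) :
    CompleteSpace (cyclicSubspace ω) :=
  (LinearMap.range (orbitMap ω)).isClosed_topologicalClosure.completeSpace_coe

theorem exists_dist_lt_of_mem_cyclicSubspace {ω v : Ell2 ι (Lp ℂ 2 μ)}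
    (hv : v ∈ cyclicSubspace ω) {ε : ℝ} (hε : 0 < ε) :
    ∃ g : Lp ℂ 1 μ, ‖v - amp ι (regularL1 μ g) ω‖ < ε := by
  obtain ⟨_, ⟨g, rfl⟩, hg⟩ := Metric.mem_closure_iff.1 hv ε hε
  rw [dist_eq_norm] at hg
  exact ⟨g, hg⟩

theorem self_mem_cyclicSubspace (ω : Ell2 ι (Lp ℂ 2 μ)) : ω ∈ cyclicSubspace ω := by
  refine Metric.mem_closure_iff.2 fun δ hδ => ?_
  obtain ⟨g, hg⟩ := exists_norm_amp_regularL1_sub_le ω (half_pos hδ)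
  refine ⟨_, ⟨g, rfl⟩, ?_⟩
  rw [dist_comm, dist_eq_norm]
  exact hg.trans_lt (half_lt_self hδ)

theorem ampTranslate_mem_cyclicSubspace (ω : Ell2 ι (Lp ℂ 2 μ)) (s : G)
    (v : Ell2 ι (Lp ℂ 2 μ)) (hv : v ∈ cyclicSubspace ω) :
    ampTranslate μ ι s v ∈ cyclicSubspace ω := by
  refine mem_topologicalClosure_of_invariant _ _ ?_ v hv
  intro u hu
  obtain ⟨g, rfl⟩ := LinearMap.mem_range.1 hu
  rw [← orbitMap_translate]
  exact LinearMap.mem_range_self _ _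

/-- The cyclic subspace is invariant under every amplified translation and its adjoint, so its
projection commutes with them. Its matrix entries therefore commute with all `λ(s)`, and hence with
`T`. -/
theorem starProjection_cyclicSubspace_comp_amp {T : Lp ℂ 2 μ →L[ℂ] Lp ℂ 2 μ}
    (hT : T ∈ groupVN μ) (ω : Ell2 ι (Lp ℂ 2 μ)) :
    (cyclicSubspace ω).starProjection ∘L amp ι T
      = amp ι T ∘L (cyclicSubspace ω).starProjection := by
  classical
  refine comp_amp_eq_amp_comp _ T fun i k y => ?_
  refine (commute_of_mem_groupVN hT (lp.evalCLM ℂ (fun _ : ι => Lp ℂ 2 μ) 2 k ∘L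
    (cyclicSubspace ω).starProjection ∘L
      lp.singleContinuousLinearMap ℂ (fun _ : ι => Lp ℂ 2 μ) 2 i) (fun s ξ => ?_) y).symm
  have h := starProjection_comm_of_invariant (cyclicSubspace ω) (ampTranslate μ ι s)
    (ampTranslate μ ι s⁻¹) (inner_ampTranslate_inv s) (ampTranslate_mem_cyclicSubspace ω s)
    (ampTranslate_mem_cyclicSubspace ω s⁻¹) (lp.single 2 i ξ)
  rw [ampTranslate, amp_single] at h
  exact congrArg (fun f : Ell2 ι (Lp ℂ 2 μ) => f k) h

/-- Von Neumann's density theorem for the group von Neumann algebra: its elements are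
approximated by the regular representation of `L¹(G)` in the ultrastrong topology. -/
theorem exists_norm_amp_sub_lt {T : Lp ℂ 2 μ →L[ℂ] Lp ℂ 2 μ} (hT : T ∈ groupVN μ)
    (ω : Ell2 ι (Lp ℂ 2 μ)) {ε : ℝ} (hε : 0 < ε) :
    ∃ g : Lp ℂ 1 μ, ‖amp ι T ω - amp ι (regularL1 μ g) ω‖ < ε := by
  refine exists_dist_lt_of_mem_cyclicSubspace ?_ hε
  have h := congrArg (fun A : Ell2 ι (Lp ℂ 2 μ) →L[ℂ] Ell2 ι (Lp ℂ 2 μ) => A ω)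
    (starProjection_cyclicSubspace_comp_amp hT ω)
  simp only [ContinuousLinearMap.comp_apply] at h
  -- As `ω` is in the cyclic subspace, the commutation makes `(1 ⊗ T)ω` a fixed vector of the
  -- projection.
  rw [Submodule.starProjection_eq_self_iff.2 (self_mem_cyclicSubspace ω)] at h
  exact Submodule.starProjection_eq_self_iff.1 h

/-- A normal map of the form `T ↦ U* (1 ⊗ T) U` that maps `λ(L¹(G))` into `LG` preserves `LG`. -/
theorem krausMap_mem_groupVN {U : Lp ℂ 2 μ →L[ℂ] Ell2 ι (Lp ℂ 2 μ)} (hU : ‖U‖ ≤ 1)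
    (h : ∀ g, ∃ g', krausMap U (regularL1 μ g) = regularL1 μ g')
    {T : Lp ℂ 2 μ →L[ℂ] Lp ℂ 2 μ} (hT : T ∈ groupVN μ) : krausMap U T ∈ groupVN μ := by
  rw [mem_groupVN_iff, mem_closure_iff_nhds]
  intro N hN
  rw [nhds_pi, Filter.mem_pi] at hN
  obtain ⟨I, hI, t, ht, htN⟩ := hN
  have hev : ∀ᶠ ε in 𝓝[>] (0 : ℝ), ∀ η ∈ I, Metric.ball (krausMap U T η) ε ⊆ t η := by
    rw [Filter.eventually_all_finite hI]
    intro η _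
    obtain ⟨δ, hδ, hδt⟩ := Metric.mem_nhds_iff.1 (ht η)
    filter_upwards [Ioo_mem_nhdsGT hδ] with ε hε
    exact (Metric.ball_subset_ball hε.2.le).trans hδt
  obtain ⟨ε, hεt, hε⟩ := (hev.and self_mem_nhdsWithin).exists
  have hε : 0 < ε := hε
  have hIf : Finite I := hI
  have hsum : Summable fun p : I × ι => ‖U p.1 p.2‖ ^ 2 :=
    (summable_prod_of_nonneg fun p => sq_nonneg _).2
      ⟨fun η => Ell2.summable_norm_sq (U η), Summable.of_finite⟩
  -- All the vectors `U η`, for the finitely many test vectors `η ∈ I`, are assembled into one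
  -- vector over `I × ι`, so that a single `g` serves them all.
  obtain ⟨g, hg⟩ := exists_norm_amp_sub_lt hT (Ell2.mk (fun p : I × ι => U p.1 p.2) hsum) hε
  obtain ⟨g', hg'⟩ := h g
  refine ⟨_, htN fun η hη => hεt η hη ?_, ⟨g', rfl⟩⟩
  rw [Metric.mem_ball, dist_comm, dist_eq_norm]
  beta_reduce
  rw [← hg']
  refine lt_of_le_of_lt ?_ hg
  rw [← sub_apply, ← map_sub, krausMap_apply]
  refine (norm_adjoint_apply_le hU _).trans ?_
  refine le_of_sq_le_sq ?_ (norm_nonneg _)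
  rw [Ell2.norm_sq_eq_tsum, Ell2.norm_sq_eq_tsum]
  exact tsum_comp_le_tsum_of_inj (Ell2.summable_norm_sq
      (amp (I × ι) T (Ell2.mk (fun p : I × ι => U p.1 p.2) hsum) - amp (I × ι) (regularL1 μ g)
        (Ell2.mk (fun p : I × ι => U p.1 p.2) hsum))) (fun _ => sq_nonneg _)
    (i := fun k => ((⟨η, hη⟩ : I), k)) (Prod.mk_right_injective _)

end Density

end WeakAmen

namespace WeakAmen

/-! ### Decomposition of `L²(G; H)` along a Hilbert basis of `H` -/

section Coordinates

set_option linter.unusedSectionVars false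

variable {α : Type*} {_ : MeasurableSpace α} {μ : Measure α}
  {H : Type*} [NormedAddCommGroup H] [InnerProductSpace ℂ H] {ι : Type*}

theorem integrable_norm_sq (Z : Lp H 2 μ) : Integrable (fun x => ‖Z x‖ ^ 2) μ :=
  (memLp_two_iff_integrable_sq_norm (Lp.aestronglyMeasurable Z)).1 (Lp.memLp Z)

/-- Bessel's inequality is integrated over finite subsets of `ι` only: the basis may be uncountable,
and each coordinate is determined only off its own null set. -/
theorem sum_norm_sq_coordinate_le (b : HilbertBasis ι ℂ H) (Z : Lp H 2 μ) (s : Finset ι) :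
    ∑ i ∈ s, ‖(innerSL ℂ (b i)).compLpL 2 μ Z‖ ^ 2 ≤ ‖Z‖ ^ 2 := by
  simp only [L2_norm_sq_eq_integral]
  rw [← integral_finsetSum _ fun i _ => integrable_norm_sq _]
  refine integral_mono_ae (integrable_finsetSum _ fun i _ => integrable_norm_sq _)
    (integrable_norm_sq Z) ?_
  have h : ∀ᵐ x ∂μ, ∀ i ∈ s, (innerSL ℂ (b i)).compLpL 2 μ Z x = inner ℂ (b i) (Z x) :=
    (Filter.eventually_all_finset s).2 fun i _ => (innerSL ℂ (b i)).coeFn_compLpL Z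
  filter_upwards [h] with x hx
  rw [Finset.sum_congr rfl fun i hi => by rw [hx i hi]]
  exact b.orthonormal.sum_inner_products_le _

theorem summable_norm_sq_coordinate (b : HilbertBasis ι ℂ H) (Z : Lp H 2 μ) :
    Summable fun i => ‖(innerSL ℂ (b i)).compLpL 2 μ Z‖ ^ 2 :=
  summable_of_sum_le (fun _ => sq_nonneg _) (sum_norm_sq_coordinate_le b Z)

/-- The coordinates of a vector valued `L²` function with respect to a Hilbert basis. -/
noncomputable def coordinates (b : HilbertBasis ι ℂ H) : Lp H 2 μ →L[ℂ] Ell2 ι (Lp ℂ 2 μ) :=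
  LinearMap.mkContinuous
    { toFun := fun Z => Ell2.mk (fun i => (innerSL ℂ (b i)).compLpL 2 μ Z)
        (summable_norm_sq_coordinate b Z)
      map_add' := fun Z Z' => by
        ext i : 2
        exact map_add ((innerSL ℂ (b i)).compLpL 2 μ) Z Z'
      map_smul' := fun c Z => by
        ext i : 2
        exact map_smul ((innerSL ℂ (b i)).compLpL 2 μ) c Z } 1
    (fun Z => by
      rw [one_mul]
      refine le_of_sq_le_sq ?_ (norm_nonneg _)
      rw [Ell2.norm_sq_eq_tsum]
      exact Real.tsum_le_of_sum_le (fun _ => sq_nonneg _) (sum_norm_sq_coordinate_le b Z))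

theorem coordinates_apply (b : HilbertBasis ι ℂ H) (Z : Lp H 2 μ) (i : ι) :
    coordinates b Z i = (innerSL ℂ (b i)).compLpL 2 μ Z := rfl

theorem norm_coordinates_le (b : HilbertBasis ι ℂ H) :
    ‖(coordinates b : Lp H 2 μ →L[ℂ] Ell2 ι (Lp ℂ 2 μ))‖ ≤ 1 :=
  LinearMap.mkContinuous_norm_le _ zero_le_one _

theorem coordinates_indicatorConstLp (b : HilbertBasis ι ℂ H) {s : Set α} (hs : MeasurableSet s)
    (hμs : μ s ≠ ∞) (c : H) (i : ι) :
    coordinates b (indicatorConstLp 2 hs hμs c) i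
      = indicatorConstLp 2 hs hμs (inner ℂ (b i) c : ℂ) := by
  rw [coordinates_apply]
  refine Lp.ext ?_
  filter_upwards [(innerSL ℂ (b i)).coeFn_compLpL (p := 2) (indicatorConstLp 2 hs hμs c),
    indicatorConstLp_coeFn (p := 2) (hs := hs) (hμs := hμs) (c := c),
    indicatorConstLp_coeFn (p := 2) (hs := hs) (hμs := hμs) (c := (inner ℂ (b i) c : ℂ))]
    with x h1 h2 h3
  rw [h1, h2, h3]
  by_cases hx : x ∈ s <;> simp [hx]

/-- Parseval's identity for vector valued `L²` functions. -/
theorem inner_coordinates [CompleteSpace H] (b : HilbertBasis ι ℂ H) (Z Z' : Lp H 2 μ) :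
    inner ℂ (coordinates b Z) (coordinates b Z') = inner ℂ Z Z' := by
  -- Both sides are continuous in each variable, so indicators suffice; for these the identity is
  -- Parseval's in `H` times the measure of an intersection.
  induction Z using Lp.induction (p := 2) (hp_ne_top := ENNReal.ofNat_ne_top) with
  | add hf hg _ h1 h2 => rw [map_add, inner_add_left, inner_add_left, h1, h2]
  | isClosed => exact isClosed_eq (by fun_prop) (by fun_prop)
  | indicatorConst c hs hμs =>
    induction Z' using Lp.induction (p := 2) (hp_ne_top := ENNReal.ofNat_ne_top) with
    | add hf hg _ h1 h2 => rw [map_add, inner_add_right, inner_add_right, h1, h2]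
    | isClosed => exact isClosed_eq (by fun_prop) (by fun_prop)
    | indicatorConst c' ht hμt =>
      rw [Lp.simpleFunc.coe_indicatorConst, Lp.simpleFunc.coe_indicatorConst, lp.inner_eq_tsum,
        L2.inner_indicatorConstLp_indicatorConstLp hs ht hμs.ne hμt.ne,
        ← b.tsum_inner_mul_inner c c', Complex.real_smul, ← tsum_mul_left]
      refine tsum_congr fun i => ?_
      rw [coordinates_indicatorConstLp, coordinates_indicatorConstLp,
        L2.inner_indicatorConstLp_indicatorConstLp hs ht hμs.ne hμt.ne, Complex.real_smul]
      congr 1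
      rw [RCLike.inner_apply, inner_conj_symm, mul_comm]

end Coordinates

/-! ### The multiplier map of a positive definite coefficient -/

section MultiplierMap

set_option linter.unusedSectionVars false

variable {G : Type u} [Group G] [TopologicalSpace G] [IsTopologicalGroup G]
  [LocallyCompactSpace G] [T2Space G] [MeasurableSpace G] [BorelSpace G]
  {μ : Measure G} [μ.IsHaarMeasure] [μ.Regular]
  {H : Type u} [NormedAddCommGroup H] [InnerProductSpace ℂ H] [CompleteSpace H] {ι : Type*}

theorem coordinates_translate (b : HilbertBasis ι ℂ H) (s : G) (Z : Lp H 2 μ) (i : ι) :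
    coordinates b (translate ℂ μ s Z) i = leftTranslate μ 2 s (coordinates b Z i) := by
  rw [coordinates_apply, coordinates_apply]
  refine Lp.ext ?_
  have h := (measurePreserving_mul_left μ s⁻¹).quasiMeasurePreserving.ae_eq_comp
    ((innerSL ℂ (b i)).coeFn_compLpL (p := 2) Z)
  filter_upwards [h, (innerSL ℂ (b i)).coeFn_compLpL (p := 2) (translate ℂ μ s Z),
    coeFn_translate (𝕜 := ℂ) μ s Z, coeFn_translate (𝕜 := ℂ) μ s
      ((innerSL ℂ (b i)).compLpL 2 μ Z)] with x h1 h2 h3 h4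
  rw [translate_eq_leftTranslate] at h4
  simp only [Function.comp_apply] at h1
  rw [h2, h3, h4, h1]

theorem integrable_smul_translate_L2 (g : Lp ℂ 1 μ) (Z : Lp H 2 μ) :
    Integrable (fun s => g s • translate ℂ μ s Z) μ :=
  integrable_smul_of_continuous_of_bounded (L1.integrable_coeFn g)
    (continuous_translate μ ENNReal.ofNat_ne_top Z) fun _ => (LinearIsometry.norm_map _ _).le

theorem amp_regularL1_coordinates (b : HilbertBasis ι ℂ H) (g : Lp ℂ 1 μ) (Z : Lp H 2 μ) :
    amp ι (regularL1 μ g) (coordinates b Z)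
      = coordinates b (∫ s, g s • translate ℂ μ s Z ∂μ) := by
  have h1 := (coordinates (μ := μ) b).integral_comp_comm (integrable_smul_translate_L2 g Z)
  rw [← h1, amp_regularL1_apply]
  refine integral_congr_ae (Eventually.of_forall fun s => ?_)
  simp only [map_smul]
  congr 1
  ext i : 2
  rw [ampTranslate_apply, coordinates_translate]

/-- The Stinespring operator of multiplication by a coefficient of `π`. -/
noncomputable def stinespring (μ : Measure G) [μ.IsHaarMeasure] [μ.Regular] (π : UnitaryRep G H)
    (ζ : H) (b : HilbertBasis ι ℂ H) : Lp ℂ 2 μ →L[ℂ] Ell2 ι (Lp ℂ 2 μ) :=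
  coordinates b ∘L fell μ π ζ

theorem norm_stinespring_le (π : UnitaryRep G H) {ζ : H} (hζ : ‖ζ‖ ≤ 1) (b : HilbertBasis ι ℂ H) :
    ‖stinespring μ π ζ b‖ ≤ 1 :=
  (ContinuousLinearMap.opNorm_comp_le _ _).trans
    (mul_le_one₀ (norm_coordinates_le b) (norm_nonneg _) ((norm_fell_le μ π ζ).trans hζ))

theorem continuous_coefficient (π : UnitaryRep G H) (ζ ζ' : H) :
    Continuous fun s => inner ℂ ζ' ((π.toHom s : H →L[ℂ] H) ζ) :=
  continuous_const.inner (π.continuous_apply ζ)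

/-- In matrix coefficients, the left side is `∫ g(s) ⟨U η', δ_s U η⟩ ds` with `U` the Fell operator,
coordinates being isometric and translation-equivariant; absorption turns the integrand into `g(s)
φ(s) ⟨η', λ(s)η⟩`. -/
theorem krausMap_stinespring_regularL1 (π : UnitaryRep G H) (ζ : H) (b : HilbertBasis ι ℂ H)
    (g : Lp ℂ 1 μ) :
    ∃ g' : Lp ℂ 1 μ, (∀ᵐ s ∂μ, g' s = inner ℂ ζ ((π.toHom s : H →L[ℂ] H) ζ) * g s) ∧
      krausMap (stinespring μ π ζ b) (regularL1 μ g) = regularL1 μ g' := by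
  have hint : Integrable (fun s => g s • inner ℂ ζ ((π.toHom s : H →L[ℂ] H) ζ)) μ :=
    integrable_smul_of_continuous_of_bounded (L1.integrable_coeFn g)
      (continuous_coefficient π ζ ζ) (C := ‖ζ‖ * ‖ζ‖) fun s => by
        simpa only [π.norm_apply] using norm_inner_le_norm (𝕜 := ℂ) ζ ((π.toHom s : H →L[ℂ] H) ζ)
  have hmem := memLp_one_iff_integrable.2 hint
  refine ⟨hmem.toLp _, ?_, ?_⟩
  · filter_upwards [hmem.coeFn_toLp] with s hs
    rw [hs, smul_eq_mul, mul_comm]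
  · ext1 η
    refine ext_inner_left ℂ fun η' => ?_
    have h1 : inner ℂ η' (regularL1 μ (hmem.toLp _) η)
        = ∫ s, hmem.toLp _ s * inner ℂ η' (leftTranslate μ 2 s η) ∂μ := by
      rw [regularL1_apply, ← integral_inner
        (integrable_smul_leftTranslate μ (L1.integrable_coeFn _) η)]
      simp only [inner_smul_right]
    rw [h1, krausMap_apply, ContinuousLinearMap.adjoint_inner_right]
    change inner ℂ (coordinates b (fell μ π ζ η'))
      (amp ι (regularL1 μ g) (coordinates b (fell μ π ζ η))) = _
    rw [amp_regularL1_coordinates, inner_coordinates, ← integral_inner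
      (integrable_smul_translate_L2 g _)]
    refine integral_congr_ae ?_
    filter_upwards [hmem.coeFn_toLp] with s hs
    rw [hs, inner_smul_right, inner_fell_translate_fell, smul_eq_mul, mul_assoc]

/-- The multiplier map attached to a positive definite coefficient. -/
noncomputable def multiplierMap (π : UnitaryRep G H) {ζ : H} (hζ : ‖ζ‖ ≤ 1)
    (b : HilbertBasis ι ℂ H) : groupVN μ →ₗ[ℂ] groupVN μ :=
  (krausMap (stinespring μ π ζ b)).restrict fun _ hT =>
    krausMap_mem_groupVN (norm_stinespring_le π hζ b)
      (fun g => (krausMap_stinespring_regularL1 π ζ b g).imp fun _ h => h.2) hT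

theorem m0Norm_coefficient_le_one (π : UnitaryRep G H) {ζ : H} (hζ : ‖ζ‖ ≤ 1)
    (hmul : IsMultiplier μ fun s => inner ℂ ζ ((π.toHom s : H →L[ℂ] H) ζ)) :
    m0Norm μ (fun s => inner ℂ ζ ((π.toHom s : H →L[ℂ] H) ζ)) ≤ 1 := by
  obtain ⟨w, b, -⟩ := exists_hilbertBasis ℂ H
  have hu : ∀ T : groupVN μ, (multiplierMap π hζ b T : Lp ℂ 2 μ →L[ℂ] Lp ℂ 2 μ)
      = krausMap (stinespring μ π ζ b) T := fun T => rfl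
  refine iInf₂_le_of_le (multiplierMap π hζ b) ⟨hmul, continuous_ultraweak_of_eq_krausMap hu,
    fun g => ?_⟩ (cbNorm_le_one (norm_stinespring_le π hζ b) hu)
  obtain ⟨g', h1, h2⟩ := krausMap_stinespring_regularL1 π ζ b g
  exact ⟨g', h1, Subtype.ext h2⟩

end MultiplierMap

end WeakAmen

namespace WeakAmen

/-! ### The approximating net -/

section Main

set_option linter.unusedSectionVars false

variable {G : Type u} [Group G] [TopologicalSpace G] [IsTopologicalGroup G]
  [LocallyCompactSpace G] [T2Space G] [MeasurableSpace G] [BorelSpace G]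
  {μ : Measure G} [μ.IsHaarMeasure] [μ.Regular]

theorem bNorm_regularCoefficient_le (ξ η : Lp ℂ 2 μ) :
    bNorm (fun s => inner ℂ η (leftTranslate μ 2 s ξ)) ≤ ‖ξ‖ₑ * ‖η‖ₑ := by
  simpa only [regularRep_apply] using bNorm_le (regularRep μ) ξ η

theorem regularCoefficient_mem_fourierAlgebra (ξ η : Lp ℂ 2 μ) :
    (fun s => inner ℂ η (leftTranslate μ 2 s ξ)) ∈ fourierAlgebra μ := by
  refine ⟨⟨_, _, _, _, regularRep μ, ξ, η, fun s => by rw [regularRep_apply]⟩, fun ε hε =>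
    ⟨_, Submodule.subset_span ⟨ξ, η, rfl⟩, ?_⟩⟩
  have h := bNorm_regularCoefficient_le (μ := μ) ξ 0
  simp only [inner_zero_left, enorm_zero, mul_zero] at h
  rw [sub_self]
  exact h.trans_lt hε

theorem m0Norm_regularCoefficient_le_one {ξ : Lp ℂ 2 μ} (hξ : ‖ξ‖ ≤ 1) :
    m0Norm μ (fun s => inner ℂ ξ (leftTranslate μ 2 s ξ)) ≤ 1 := by
  have h := isMultiplier_regularCoefficient μ ξ ξ
  simp only [← regularRep_apply] at h ⊢
  exact m0Norm_coefficient_le_one (regularRep μ) hξ h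

theorem norm_regularCoefficient_sub_one_le {ξ : Lp ℂ 2 μ} (hξ : ‖ξ‖ = 1) (s : G) :
    ‖inner ℂ ξ (leftTranslate μ 2 s ξ) - 1‖ ≤ ‖leftTranslate μ 2 s ξ - ξ‖ := by
  have h1 : (1 : ℂ) = inner ℂ ξ ξ := by
    rw [inner_self_eq_norm_sq_to_K, hξ]
    simp
  rw [h1, ← inner_sub_right]
  simpa [hξ] using norm_inner_le_norm (𝕜 := ℂ) ξ (leftTranslate μ 2 s ξ - ξ)

/-- Positive definite coefficients of the regular representation approximating `1`. -/
theorem IsAmenable.exists_net (hG : IsAmenable μ) :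
    ∃ (ι : Type u) (_ : Nonempty ι) (_ : Preorder ι) (_ : IsDirectedOrder ι) (a : ι → G → ℂ),
      (∀ i, a i ∈ fourierAlgebra μ) ∧ (∀ i, bNorm (a i) ≤ 1) ∧ (∀ i, m0Norm μ (a i) ≤ 1) ∧
      ∀ K : Set G, IsCompact K → TendstoUniformlyOn a (fun _ => 1) atTop K := by
  -- The net is indexed by pairs `(K, n)`, with `ξ (K, n)` moved by at most `1/(n+1)` on `K`.
  choose ξ hξ hξK using fun p : TopologicalSpace.Compacts G × ℕ =>
    hG.exists_norm_leftTranslate_sub_le p.1.isCompact (Nat.one_div_pos_of_nat (α := ℝ) (n := p.2))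
  refine ⟨TopologicalSpace.Compacts G × ℕ, inferInstance, inferInstance, inferInstance,
    fun p s => inner ℂ (ξ p) (leftTranslate μ 2 s (ξ p)),
    fun p => regularCoefficient_mem_fourierAlgebra _ _, fun p => ?_,
    fun p => m0Norm_regularCoefficient_le_one (hξ p).le, fun K hK => ?_⟩
  · refine (bNorm_regularCoefficient_le (ξ p) (ξ p)).trans ?_
    rw [← ofReal_norm, hξ]
    simp
  · rw [Metric.tendstoUniformlyOn_iff]
    intro ε hε
    obtain ⟨n, hn⟩ := exists_nat_one_div_lt hε
    filter_upwards [eventually_ge_atTop ((⟨K, hK⟩ : TopologicalSpace.Compacts G), n)]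
      with p hp s hs
    rw [dist_comm, dist_eq_norm]
    refine (norm_regularCoefficient_sub_one_le (hξ p) s).trans_lt
      (((hξK p s (hp.1 hs)).trans ?_).trans_lt hn)
    exact Nat.one_div_le_one_div hp.2

end Main

end WeakAmen

theorem mainTheorem2 {G : Type u} [Group G] [TopologicalSpace G] [IsTopologicalGroup G]
    [LocallyCompactSpace G] [T2Space G] [MeasurableSpace G] [BorelSpace G]
    (μ : MeasureTheory.Measure G) [μ.IsHaarMeasure] [μ.Regular]
    (hG : WeakAmen.IsAmenable μ) :
    (∃ (ι : Type u) (_ : Nonempty ι) (_ : Preorder ι) (_ : IsDirectedOrder ι) (a : ι → G → ℂ),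
      (∀ i, a i ∈ WeakAmen.fourierAlgebra μ) ∧
      (∀ i, WeakAmen.bNorm (a i) ≤ 1) ∧
      (∀ i, WeakAmen.m0Norm μ (a i) ≤ 1) ∧
      ∀ K : Set G, IsCompact K → TendstoUniformlyOn a (fun _ => 1) Filter.atTop K) ∧
    WeakAmen.IsWeaklyAmenable μ ∧ WeakAmen.cowlingHaagerup μ = 1 := by
  obtain ⟨ι, i₁, i₂, i₃, a, ha, hb, hm, hK⟩ := hG.exists_net
  have h1 : WeakAmen.HasApproxOne μ 1 := ⟨ι, i₁, i₂, i₃, a, ha, by simpa using hm, hK⟩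
  refine ⟨⟨ι, i₁, i₂, i₃, a, ha, hb, hm, hK⟩, ⟨1, le_rfl, h1⟩, le_antisymm ?_ ?_⟩
  · exact iInf₂_le_of_le 1 ⟨le_rfl, h1⟩ (by simp)
  -- The lower bound holds because only constants `C ≥ 1` are admitted.
  · exact le_iInf₂ fun C hC => by exact_mod_cast hC.1
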